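/- Let $G=(V,E)$ be a finite, simple, connected graph, let $B\subseteq V$ (possibly empty), and let $\tau\in\{-1,1\}^B$ be a fixed (disorder-independent) boundary condition. Put $V^\circ:=V\setminus B$, and assume that $V^\circ$ is nonempty, that the subgraph of $G$ induced on $V^\circ$ is connected, and that $|E|\ge 2$. Let $J=(J_e)_{e\in E}$ be i.i.d. standard Gaussian random variables, and for $\sigma\in\{-1,1\}^V$ let $H_J(\sigma):=-\sum_{\{i,j\}\in E}J_{ij}\sigma_i\sigma_j$. Let $\sigma=\sigma(J)$ be a ground state, that is, a minimizer of $H_J$ among the configurations that agree with $\tau$ on $B$ (no constraint if $B=\emptyset$, the free boundary condition). Almost surely the ground state is unique if $B\neq\emptyset$ and unique up to a global sign if $B=\emptyset$, and $F$ below does not depend on this sign. For $A\subseteq V^\circ$ let $\Delta(A):=H_J(\sigma^A)-H_J(\sigma)$, where $\sigma^A$ is obtained from $\sigma$ by overturning all spins in $A$, and let $\partial A$ be the set of all edges from $A$ to $V\setminus A$. Put $$F:=\min\Bigl\{\frac{\Delta(A)}{|\partial A|}\;:\;A\subseteq V^\circ,\ \frac{|V^\circ|}{4}\le |A|\le \frac{3|V^\circ|}{4}\Bigr\},$$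 where the ratio is read as $0$ if $\partial A=\emptyset$ and the minimum as $+\infty$ if there is no such $A$. Let $d$ be the graph distance on $G$, and suppose that $\alpha,\beta,\gamma,\delta>0$ are constants such that for every $i\in V^\circ$ and every real $r\ge 1$, the number of $j\in V$ with $d(i,j)\le r$ is at most $\alpha r^\beta$, and the number of $j\in V$ with $\min\{d(j,k):k\in B\}\le r$ is at most $\gamma|B|r^\delta$ (the minimum being $+\infty$ if $B=\emptyset$). Then there are a positive universal constant $C_1$ and a positive constant $C_2$ depending only on $\alpha,\beta,\gamma,\delta$ such that for every $p\in(0,\tfrac12)$, $$\mathbb{P}\bigl(F\ge C_1\sqrt{p\log|E|}\bigr)\le \frac{1}{|E|}+\frac{4}{|V^\circ|}+\frac{C_2\bigl(|V^\circ|p^{-\beta}+|B|^2p^{-2\delta}\bigr)}{|V^\circ|^2}.$$ -/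

import Mathlib

open MeasureTheory ProbabilityTheory

namespace EdwardsAnderson

variable {V : Type*} [Fintype V] [DecidableEq V]

/-- The Hamiltonian `H_J(σ) = -∑_{{i,j} ∈ E} J_{ij} σ_i σ_j` of a spin configuration
`σ ∈ {-1, 1}^V`; the two spin values are the units of `ℤ`, and for an edge `e = {i, j}` the
number `(e.map σ).mul` is `σ_i σ_j`. -/
noncomputable def hamiltonian (G : SimpleGraph V) [DecidableRel G.Adj] (J : G.edgeSet → ℝ)
    (σ : V → ℤˣ) : ℝ :=
  -∑ e : G.edgeSet, J e * ((((e : Sym2 V).map σ).mul : ℤˣ) : ℤ)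

/-- `σ` is a ground state in the environment `J` under the boundary condition `τ` on `B`: it
agrees with `τ` on `B` and minimizes the Hamiltonian among all such configurations. If `B` is
empty, there is no constraint; this is the free boundary condition. -/
def IsGroundState (G : SimpleGraph V) [DecidableRel G.Adj] (B : Finset V) (τ : B → ℤˣ)
    (J : G.edgeSet → ℝ) (σ : V → ℤˣ) : Prop :=
  (∀ i : B, σ i = τ i) ∧
    ∀ σ' : V → ℤˣ, (∀ i : B, σ' i = τ i) → hamiltonian G J σ ≤ hamiltonian G J σ'

/-- The configuration obtained from `σ` by overturning all spins in `A`. -/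
def overturn (A : Finset V) (σ : V → ℤˣ) : V → ℤˣ :=
  fun i => if i ∈ A then -σ i else σ i

/-- The energy cost `Δ(A)` of overturning all spins in `A` in the configuration `σ`. -/
noncomputable def energyCost (G : SimpleGraph V) [DecidableRel G.Adj] (J : G.edgeSet → ℝ)
    (σ : V → ℤˣ) (A : Finset V) : ℝ :=
  hamiltonian G J (overturn A σ) - hamiltonian G J σ

/-- The edge boundary `∂A`: the edges from `A` to `V \ A`. -/
def edgeBoundary (G : SimpleGraph V) [DecidableRel G.Adj] (A : Finset V) : Finset (Sym2 V) :=
  G.edgeFinset.filter (fun e => ∃ i ∈ A, ∃ j ∈ Aᶜ, e = s(i, j))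

/-- The subsets `A` of `V° = V \ B` with `|V°| / 4 ≤ |A| ≤ 3 |V°| / 4`. -/
noncomputable def midsizeRegions (B : Finset V) : Finset (Finset V) :=
  {A ∈ (Bᶜ).powerset | ((Bᶜ).card : ℝ) / 4 ≤ A.card ∧ (A.card : ℝ) ≤ 3 * (Bᶜ).card / 4}

/-- `F`, the minimum of `Δ(A) / |∂A|` over the regions `A ⊆ V°` with
`|V°| / 4 ≤ |A| ≤ 3 |V°| / 4`. The ratio is `0` if `∂A` is empty, and the minimum is `⊤` if there
is no such region. -/
noncomputable def minInterfaceRatio (G : SimpleGraph V) [DecidableRel G.Adj] (B : Finset V)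
    (J : G.edgeSet → ℝ) (σ : V → ℤˣ) : WithTop ℝ :=
  (midsizeRegions B).inf
    (fun A => ((energyCost G J σ A / (edgeBoundary G A).card : ℝ) : WithTop ℝ))

/-- The growth conditions: balls of radius `r ≥ 1` around vertices of `V° = V \ B` have at most
`α r ^ β` vertices, and at most `γ |B| r ^ δ` vertices are within distance `r ≥ 1` of `B`. -/
def GrowthBounds (G : SimpleGraph V) (B : Finset V) (α β γ δ : ℝ) : Prop :=
  (∀ i ∉ B, ∀ r : ℝ, 1 ≤ r → ({j : V | (G.dist i j : ℝ) ≤ r}.ncard : ℝ) ≤ α * r ^ β) ∧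
    ∀ r : ℝ, 1 ≤ r → ({j : V | ∃ k ∈ B, (G.dist j k : ℝ) ≤ r}.ncard : ℝ) ≤ γ * B.card * r ^ δ

end EdwardsAnderson

/-! Chaos forces a cheap interface. Let `J' = (1 - p) J + √(1 - (1 - p)²) Z` with an independent
copy `Z` of `J`, let `σ` and `σ'` be ground states for `J` and `J'`, and let `A` be the set where
they differ. Since `σ'` minimizes the energy for `J'`, overturning `A` in `σ` costs at most `2D` per
boundary edge, where `D` bounds `|J_e - J'_e|` (`energyCost_disagreement_le`). Gaussian tails give
`D ≤ 7 √(p log |E|)` outside an event of probability at most `1/|E|`. It remains to see that `A` is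
usually of intermediate size, which by `minInterfaceRatio_lt` holds once the squared overlap `(∑ σ_i
σ'_i)²` over `V°` is less than `|V°|²/4`.

By Markov's inequality this needs only the second moment of the overlap, a double sum of noise
correlations of the functions `σ_i σ_j` of `J`. Flipping all spins in a ball around `i` that
contains neither `j` nor a point of `B` is a gauge transformation: it negates the couplings leaving
the ball and changes the sign of `σ_i σ_j`. Cuts of different radii are disjoint, so `σ_i σ_j` is
odd in `m` disjoint blocks of couplings, `m` being the smaller of the distances from `i` to `j` and
to `B`. Such a function has no Hermite component of degree below `m`, whence correlation at most `ρ
^ m` (`gaussianCorr_le_pow`). The growth bounds then control the double sum.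

Hermite expansions are avoided. For small `r`, antisymmetrizing the Mehler kernel block by block
gives correlation at most `K r ^ m`. The inequality `gaussianCorr_sq_le`, iterated from `ρ` to `ρ ^
(2 ^ k)`, transfers this to every `ρ` and removes `K`. -/

namespace EdwardsAnderson

/-! ### Gaussian vectors, rotations and noise correlation -/

section Gaussian

variable {ι : Type*} [Fintype ι]

/-- The law of a family of i.i.d. standard Gaussian random variables. -/
noncomputable abbrev stdGaussianPi (ι : Type*) [Fintype ι] : Measure (ι → ℝ) :=
  Measure.pi fun _ => gaussianReal 0 1

instance isGaussian_stdGaussianPi : IsGaussian (stdGaussianPi ι) := by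
  have h1 : iIndepFun (fun (i : ι) (x : ι → ℝ) => x i) (stdGaussianPi ι) :=
    iIndepFun_pi (Ω := fun _ => ℝ) (𝓧 := fun _ => ℝ) (μ := fun _ => gaussianReal 0 1)
      (X := fun (_ : ι) (y : ℝ) => y)
      fun _ => measurable_id.aemeasurable
  have h2 : ∀ i : ι, HasGaussianLaw (fun x : ι → ℝ => x i) (stdGaussianPi ι) := fun i => by
    refine ⟨?_⟩
    have := (measurePreserving_eval (α := fun _ : ι => ℝ) (fun _ => gaussianReal 0 1) i).map_eq
    change IsGaussian ((stdGaussianPi ι).map (Function.eval i))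
    rw [this]
    infer_instance
  have := (iIndepFun.hasGaussianLaw h2 h1).isGaussian_map
  simpa using this

theorem measurePreserving_signs (ε : ι → ℝ) (hε : ∀ e, ε e = 1 ∨ ε e = -1) :
    MeasurePreserving (fun (x : ι → ℝ) e => ε e * x e) (stdGaussianPi ι) (stdGaussianPi ι) := by
  refine measurePreserving_pi (fun _ => gaussianReal 0 1) (fun _ => gaussianReal 0 1)
    (f := fun e (y : ℝ) => ε e * y) fun e => ⟨by fun_prop, ?_⟩
  rw [gaussianReal_map_const_mul]
  congr 1
  · simp
  · ext
    rcases hε e with h | h <;> simp [h]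

/-- Rotation invariance of a centred Gaussian law, with angle `arccos a`; the sign condition on `b`
is what identifies it with the sine. Centring follows from the symmetry `x ↦ -x`. -/
theorem measurePreserving_rotation {a b : ℝ} (hb : 0 ≤ b) (hab : a ^ 2 + b ^ 2 = 1) :
    MeasurePreserving
      (fun q : (ι → ℝ) × (ι → ℝ) => (a • q.1 + b • q.2, -b • q.1 + a • q.2))
      ((stdGaussianPi ι).prod (stdGaussianPi ι)) ((stdGaussianPi ι).prod (stdGaussianPi ι)) := by
  have hzero : ∀ L : StrongDual ℝ (ι → ℝ), ∫ x, L x ∂(stdGaussianPi ι) = 0 := fun L => by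
    have M := measurePreserving_signs (ι := ι) (fun _ => -1) (fun _ => Or.inr rfl)
    have h' : ∫ x, L x ∂(stdGaussianPi ι) = ∫ x, L (-x) ∂(stdGaussianPi ι) := by
      have h := integral_map (μ := stdGaussianPi ι) M.measurable.aemeasurable (f := fun x => L x)
        (by fun_prop)
      rw [M.map_eq] at h
      rw [h]
      refine integral_congr_ae (ae_of_all _ fun x => ?_)
      simp only
      congr 1
      ext e
      simp
    simp only [map_neg, integral_neg] at h'
    linarith
  have h := IsGaussian.map_rotation_eq_self_of_forall_strongDual_eq_zero hzero (Real.arccos a)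
  have ha1 : -1 ≤ a := by nlinarith [sq_nonneg b]
  have ha2 : a ≤ 1 := by nlinarith [sq_nonneg b]
  have hs : Real.sin (Real.arccos a) = b := by
    rw [Real.sin_arccos, show 1 - a ^ 2 = b ^ 2 by linarith, Real.sqrt_sq hb]
  refine ⟨by fun_prop, ?_⟩
  rw [← h]
  congr 1
  · ext1 q
    rw [ContinuousLinearMap.rotation_apply, Real.cos_arccos ha1 ha2, hs]

/-- The expectation of `f(X) f(Y)` where `X` and `Y` are standard Gaussian vectors whose
coordinates have correlation `ρ`. -/
noncomputable def gaussianCorr (ρ : ℝ) (f : (ι → ℝ) → ℝ) : ℝ :=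
  ∫ x, f x * ∫ z, f (ρ • x + √(1 - ρ ^ 2) • z) ∂(stdGaussianPi ι) ∂(stdGaussianPi ι)

theorem integrable_of_abs_le_one {α : Type*} [MeasurableSpace α] {μ : Measure α}
    [IsFiniteMeasure μ] {f : α → ℝ} (hf : Measurable f) (hb : ∀ x, |f x| ≤ 1) :
    Integrable f μ :=
  Integrable.of_bound hf.aestronglyMeasurable 1 (ae_of_all _ fun x => by simpa using hb x)

theorem abs_integral_le_one {α : Type*} [MeasurableSpace α] {μ : Measure α}
    [IsProbabilityMeasure μ] {f : α → ℝ} (hb : ∀ x, |f x| ≤ 1) : |∫ x, f x ∂μ| ≤ 1 := by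
  simpa using norm_integral_le_of_norm_le_const (μ := μ) (f := f) (C := 1)
    (ae_of_all _ fun x => by simpa using hb x)

theorem sq_integral_le {α : Type*} [MeasurableSpace α] {μ : Measure α}
    [IsProbabilityMeasure μ] {f : α → ℝ} (hf : Measurable f) (hb : ∀ x, |f x| ≤ 1) :
    (∫ x, f x ∂μ) ^ 2 ≤ ∫ x, f x ^ 2 ∂μ := by
  have h := integral_nonneg (μ := μ) (f := fun x => (f x - ∫ y, f y ∂μ) ^ 2)
    (fun x => sq_nonneg _)
  have h2 : ∀ x, |f x ^ 2| ≤ 1 := fun x => by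
    rw [abs_pow]; exact pow_le_one₀ (abs_nonneg _) (hb x)
  have hi := integrable_of_abs_le_one (μ := μ) hf hb
  have hi2 := integrable_of_abs_le_one (μ := μ) (hf.pow_const 2) h2
  set c := ∫ y, f y ∂μ with hc
  have : ∫ x, (f x - c) ^ 2 ∂μ = ∫ x, f x ^ 2 ∂μ - c ^ 2 := by
    have e : (fun x => (f x - c) ^ 2) = fun x => f x ^ 2 - (2 * c * f x - c ^ 2) := by
      ext x; ring
    have hj : Integrable (fun x => 2 * c * f x) μ := hi.const_mul _
    have hk : Integrable (fun x => 2 * c * f x - c ^ 2) μ := hj.sub (integrable_const _)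
    rw [e, integral_sub hi2 hk, integral_sub hj (integrable_const _),
      integral_const_mul, ← hc]
    simp
    ring
  linarith

/-- Two standard Gaussian vectors built independently from a third one, each with correlation `ρ`
to it, have the joint law of two vectors with correlation `ρ ^ 2`. -/
theorem integral_two_step {ρ : ℝ} (h0 : 0 < ρ) (h1 : ρ < 1) {F : (ι → ℝ) → (ι → ℝ) → ℝ}
    (hF : Measurable fun q : (ι → ℝ) × (ι → ℝ) => F q.1 q.2) :
    ∫ q : (ι → ℝ) × (ι → ℝ) × (ι → ℝ),
        F (ρ • q.1 + √(1 - ρ ^ 2) • q.2.1) (ρ • q.1 + √(1 - ρ ^ 2) • q.2.2)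
        ∂((stdGaussianPi ι).prod ((stdGaussianPi ι).prod (stdGaussianPi ι))) =
      ∫ q : (ι → ℝ) × (ι → ℝ), F q.1 (ρ ^ 2 • q.1 + √(1 - (ρ ^ 2) ^ 2) • q.2)
        ∂((stdGaussianPi ι).prod (stdGaussianPi ι)) := by
  set γ := stdGaussianPi ι
  set s := √(1 - ρ ^ 2) with hs
  have hs2 : s ^ 2 = 1 - ρ ^ 2 := Real.sq_sqrt (by nlinarith)
  have hs0 : 0 ≤ s := Real.sqrt_nonneg _
  set t := √(1 + ρ ^ 2) with ht
  have ht2 : t ^ 2 = 1 + ρ ^ 2 := Real.sq_sqrt (by positivity)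
  have ht0 : 0 < t := Real.sqrt_pos.2 (by positivity)
  have hst : √(1 - (ρ ^ 2) ^ 2) = s * t := by
    rw [hs, ht, ← Real.sqrt_mul (by nlinarith)]
    ring_nf
  have R1 := measurePreserving_rotation (ι := ι) (a := ρ) (b := s) hs0 (by rw [hs2]; ring)
  -- `R1` turns `(x, z)` into `u = ρ x + s z` and `w = -s x + ρ z`. Then `ρ x + s z' = ρ² u + s (z'
  -- - ρ w)`, and `(z' - ρ w) / t` is the standard Gaussian produced by this second rotation.
  have R2 := measurePreserving_rotation (ι := ι) (a := -ρ / t) (b := 1 / t) (by positivity)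
    (by field_simp; rw [ht2]; ring)
  have A := (measurePreserving_prodAssoc γ γ γ)
  have M : MeasurePreserving _ (γ.prod (γ.prod γ)) (γ.prod γ) :=
    ((MeasurePreserving.id γ).prod measurePreserving_fst).comp
      (((MeasurePreserving.id γ).prod R2).comp (A.comp ((R1.prod (MeasurePreserving.id γ)).comp
        (MeasurePreserving.symm _ A))))
  have hm := integral_map (μ := γ.prod (γ.prod γ)) M.measurable.aemeasurable
    (f := fun q : (ι → ℝ) × (ι → ℝ) => F q.1 (ρ ^ 2 • q.1 + √(1 - (ρ ^ 2) ^ 2) • q.2))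
    (by
      refine Measurable.aestronglyMeasurable ?_
      have : Measurable fun q : (ι → ℝ) × (ι → ℝ) =>
        (q.1, ρ ^ 2 • q.1 + √(1 - (ρ ^ 2) ^ 2) • q.2) := by fun_prop
      exact hF.comp this)
  rw [M.map_eq] at hm
  rw [hm]
  · refine integral_congr_ae (ae_of_all _ fun q => ?_)
    obtain ⟨x, z, z'⟩ := q
    simp only [MeasurableEquiv.prodAssoc, Function.comp, Prod.map, id, hst, MeasurableEquiv.coe_mk,
      MeasurableEquiv.symm_mk, Equiv.prodAssoc, Equiv.coe_fn_mk, Equiv.symm_mk]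
    congr 1
    ext e
    simp only [Pi.add_apply, Pi.smul_apply, smul_eq_mul]
    field_simp
    have : s * (s * x e) = (1 - ρ ^ 2) * x e := by rw [← hs2]; ring
    linear_combination -ρ * this

/-- With `g` the noise average of `f`, boundedness gives `(∫ f g)² ≤ ∫ g²`. Writing `g²` with two
independent noises turns its integral into a correlation at `ρ²`: this is the semigroup property. -/
theorem gaussianCorr_sq_le {ρ : ℝ} (h0 : 0 < ρ) (h1 : ρ < 1) {f : (ι → ℝ) → ℝ}
    (hf : Measurable f) (hb : ∀ x, |f x| ≤ 1) :
    gaussianCorr ρ f ^ 2 ≤ gaussianCorr (ρ ^ 2) f := by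
  set γ := stdGaussianPi ι with hγ
  set g : (ι → ℝ) → ℝ := fun x => ∫ z, f (ρ • x + √(1 - ρ ^ 2) • z) ∂γ with hg
  have hfm : Measurable fun q : (ι → ℝ) × (ι → ℝ) => f (ρ • q.1 + √(1 - ρ ^ 2) • q.2) :=
    hf.comp (by fun_prop)
  have hgm : Measurable g := (hfm.stronglyMeasurable.integral_prod_right).measurable
  have hgb : ∀ x, |g x| ≤ 1 := fun x => abs_integral_le_one fun z => hb _
  have hfg : ∀ x, |f x * g x| ≤ 1 := fun x => by
    rw [abs_mul]; exact mul_le_one₀ (hb x) (abs_nonneg _) (hgb x)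
  have hg2 : ∀ x, |g x ^ 2| ≤ 1 := fun x => by
    rw [abs_pow]; exact pow_le_one₀ (abs_nonneg _) (hgb x)
  have hfg2 : ∀ x, |(f x * g x) ^ 2| ≤ 1 := fun x => by
    rw [abs_pow]; exact pow_le_one₀ (abs_nonneg _) (hfg x)
  calc gaussianCorr ρ f ^ 2 = (∫ x, f x * g x ∂γ) ^ 2 := rfl
    _ ≤ ∫ x, (f x * g x) ^ 2 ∂γ := sq_integral_le (hf.mul hgm) hfg
    _ ≤ ∫ x, g x ^ 2 ∂γ := by
      refine integral_mono (integrable_of_abs_le_one ((hf.mul hgm).pow_const 2) hfg2)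
        (integrable_of_abs_le_one (hgm.pow_const 2) hg2) fun x => ?_
      have : f x ^ 2 ≤ 1 := by rw [← sq_abs]; exact pow_le_one₀ (abs_nonneg _) (hb x)
      have h3 := sq_nonneg (g x)
      simp only [mul_pow]
      nlinarith
    _ = ∫ q : (ι → ℝ) × (ι → ℝ) × (ι → ℝ),
          f (ρ • q.1 + √(1 - ρ ^ 2) • q.2.1) * f (ρ • q.1 + √(1 - ρ ^ 2) • q.2.2)
          ∂(γ.prod (γ.prod γ)) := by
      rw [integral_prod]
      · refine integral_congr_ae (ae_of_all _ fun x => ?_)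
        simp only [hg, sq]
        exact (integral_prod_mul _ _).symm
      · refine integrable_of_abs_le_one ?_ fun q => ?_
        · exact (hf.comp (by fun_prop)).mul (hf.comp (by fun_prop))
        · rw [abs_mul]; exact mul_le_one₀ (hb _) (abs_nonneg _) (hb _)
    _ = ∫ q : (ι → ℝ) × (ι → ℝ), f q.1 * f (ρ ^ 2 • q.1 + √(1 - (ρ ^ 2) ^ 2) • q.2)
          ∂(γ.prod γ) :=
      integral_two_step h0 h1 (F := fun a b => f a * f b)
        ((hf.comp measurable_fst).mul (hf.comp measurable_snd))
    _ = gaussianCorr (ρ ^ 2) f := by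
      rw [integral_prod]
      · simp only [integral_const_mul]
        rfl
      · refine integrable_of_abs_le_one ?_ fun q => ?_
        · exact (hf.comp (by fun_prop)).mul (hf.comp (by fun_prop))
        · rw [abs_mul]; exact mul_le_one₀ (hb _) (abs_nonneg _) (hb _)

end Gaussian

/-! ### The Mehler kernel and exponential integrability -/

section Density

variable {ι : Type*} [Fintype ι]

theorem pi_withDensity {α : ι → Type*} [∀ i, MeasurableSpace (α i)] (μ : ∀ i, Measure (α i))
    [∀ i, IsProbabilityMeasure (μ i)] {f : ∀ i, α i → ENNReal} (hf : ∀ i, Measurable (f i))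
    [∀ i, SigmaFinite ((μ i).withDensity (f i))] :
    Measure.pi (fun i => (μ i).withDensity (f i)) =
      (Measure.pi μ).withDensity fun x => ∏ i, f i (x i) := by
  refine Measure.pi_eq fun s hs => ?_
  rw [withDensity_apply _ (MeasurableSet.univ_pi hs), ← lintegral_indicator
    (MeasurableSet.univ_pi hs)]
  have h : (Set.univ.pi s).indicator (fun x => ∏ i, f i (x i)) =
      fun x => ∏ i, (s i).indicator (f i) (x i) := by
    classical
    ext x
    by_cases hx : x ∈ Set.univ.pi s
    · rw [Set.indicator_of_mem hx]
      exact Finset.prod_congr rfl fun i _ => (Set.indicator_of_mem (hx i trivial) _).symm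
    · rw [Set.indicator_of_notMem hx]
      simp only [Set.mem_pi, Set.mem_univ, forall_const, not_forall] at hx
      obtain ⟨i, hi⟩ := hx
      exact (Finset.prod_eq_zero (Finset.mem_univ i) (Set.indicator_of_notMem hi _)).symm
  have hprod := lintegral_prod_eq_prod_lintegral_of_indepFun (μ := Measure.pi μ) Finset.univ
    (fun i x => (s i).indicator (f i) (x i))
    (iIndepFun_pi (X := fun i => (s i).indicator (f i))
      fun i => ((hf i).indicator (hs i)).aemeasurable)
    fun i => ((hf i).indicator (hs i)).comp (measurable_pi_apply i)
  rw [h, hprod]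
  refine Finset.prod_congr rfl fun i _ => ?_
  rw [withDensity_apply _ (hs i), ← lintegral_indicator (hs i)]
  exact (measurePreserving_eval μ i).lintegral_comp ((hf i).indicator (hs i))

/-- The Mehler kernel: the density of the law of `r x + √(1 - r²) Z`, for `Z` standard Gaussian,
relative to the standard Gaussian law. -/
noncomputable def mehlerKernel (r x y : ℝ) : ℝ :=
  (√(1 - r ^ 2))⁻¹ * Real.exp (-(r ^ 2 / (2 * (1 - r ^ 2)) * (x ^ 2 + y ^ 2)) +
    r / (1 - r ^ 2) * (x * y))

theorem mehlerKernel_nonneg (r x y : ℝ) : 0 ≤ mehlerKernel r x y := by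
  unfold mehlerKernel; positivity

theorem measurable_mehlerKernel (r x : ℝ) : Measurable (mehlerKernel r x) := by
  unfold mehlerKernel; fun_prop

theorem gaussianReal_eq_withDensity_mehlerKernel {r : ℝ} (hr : r ^ 2 < 1) (x : ℝ) :
    gaussianReal (r * x) (1 - r ^ 2).toNNReal =
      (gaussianReal 0 1).withDensity fun y => ENNReal.ofReal (mehlerKernel r x y) := by
  have hv : (1 - r ^ 2).toNNReal ≠ 0 := by
    rw [Ne, Real.toNNReal_eq_zero]; linarith
  have hv' : 0 < 1 - r ^ 2 := by linarith
  rw [gaussianReal_of_var_ne_zero _ hv, gaussianReal_of_var_ne_zero _ one_ne_zero,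
    ← withDensity_mul _ (measurable_gaussianPDF _ _)
      (measurable_mehlerKernel r x).ennreal_ofReal]
  congr 1
  ext1 y
  rw [Pi.mul_apply, gaussianPDF, gaussianPDF, ← ENNReal.ofReal_mul (gaussianPDFReal_nonneg _ _ _)]
  congr 1
  rw [gaussianPDFReal, gaussianPDFReal, mehlerKernel, Real.coe_toNNReal _ hv'.le,
    mul_mul_mul_comm, ← Real.exp_add, Real.sqrt_mul (by positivity)]
  congr 1
  · simp; ring
  · congr 1
    simp only [NNReal.coe_one]
    field_simp
    ring

theorem map_gaussianReal_affine {r : ℝ} (hr : r ^ 2 < 1) (a : ℝ) :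
    (gaussianReal 0 1).map (fun z => a + √(1 - r ^ 2) * z) =
      gaussianReal a (1 - r ^ 2).toNNReal := by
  have h : (fun z => a + √(1 - r ^ 2) * z) = (fun z => a + z) ∘ fun z => √(1 - r ^ 2) * z := rfl
  rw [h, ← Measure.map_map (by fun_prop) (by fun_prop), gaussianReal_map_const_mul,
    gaussianReal_map_const_add]
  congr 1
  · simp
  · ext
    rw [Real.coe_toNNReal _ (by linarith)]
    simp [Real.sq_sqrt (show 0 ≤ 1 - r ^ 2 by linarith)]

/-- This frees `f` from the noise parameter, so that sign changes in one of the two vectors can be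
carried out with the other fixed. -/
theorem integral_affine_eq {r : ℝ} (hr : r ^ 2 < 1) {f : (ι → ℝ) → ℝ} (hf : Measurable f)
    (x : ι → ℝ) :
    ∫ z, f (r • x + √(1 - r ^ 2) • z) ∂(stdGaussianPi ι) =
      ∫ y, (∏ e, mehlerKernel r (x e) (y e)) * f y ∂(stdGaussianPi ι) := by
  have hlaw : (stdGaussianPi ι).map (fun z => r • x + √(1 - r ^ 2) • z) =
      (stdGaussianPi ι).withDensity
        fun y => ∏ e, ENNReal.ofReal (mehlerKernel r (x e) (y e)) := by
    have hs : ∀ e, SigmaFinite ((gaussianReal 0 1).withDensity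
        fun y => ENNReal.ofReal (mehlerKernel r (x e) y)) := fun e => by
      rw [← gaussianReal_eq_withDensity_mehlerKernel hr]; infer_instance
    rw [← pi_withDensity (fun _ => gaussianReal 0 1)
      (f := fun e y => ENNReal.ofReal (mehlerKernel r (x e) y))
      fun e => (measurable_mehlerKernel r (x e)).ennreal_ofReal]
    have hp : ∀ e : ι, IsProbabilityMeasure
        ((gaussianReal 0 1).map fun z => r * x e + √(1 - r ^ 2) * z) := fun e => by
      rw [map_gaussianReal_affine hr]; infer_instance
    have h := Measure.pi_map_pi (μ := fun _ : ι => gaussianReal 0 1)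
      (f := fun e z => r * x e + √(1 - r ^ 2) * z) (fun e => by fun_prop)
    simp only [map_gaussianReal_affine hr, gaussianReal_eq_withDensity_mehlerKernel hr] at h
    exact h
  have h1 := integral_map (μ := stdGaussianPi ι) (φ := fun z => r • x + √(1 - r ^ 2) • z)
    (by fun_prop) (f := f) hf.aestronglyMeasurable
  rw [← h1, hlaw, integral_withDensity_eq_integral_toReal_smul]
  · refine integral_congr_ae (ae_of_all _ fun y => ?_)
    simp only [smul_eq_mul, ENNReal.toReal_prod]
    congr 1
    exact Finset.prod_congr rfl fun e _ => ENNReal.toReal_ofReal (mehlerKernel_nonneg _ _ _)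
  · exact Finset.measurable_prod _ fun e _ =>
      ((measurable_mehlerKernel r (x e)).comp (measurable_pi_apply e)).ennreal_ofReal
  · exact ae_of_all _ fun y => ENNReal.prod_lt_top fun e _ => ENNReal.ofReal_lt_top

theorem integrable_exp_sq_div_eight :
    Integrable (fun x : ℝ => Real.exp (x ^ 2 / 8)) (gaussianReal 0 1) := by
  rw [gaussianReal_of_var_ne_zero _ one_ne_zero, integrable_withDensity_iff_integrable_smul'
    (measurable_gaussianPDF _ _) (ae_of_all _ fun _ => gaussianPDF_lt_top)]
  have h := (integrable_exp_neg_mul_sq (b := 3 / 8) (by norm_num)).const_mul (√(2 * Real.pi))⁻¹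
  refine h.congr (ae_of_all _ fun x => ?_)
  simp only [toReal_gaussianPDF, gaussianPDFReal, smul_eq_mul, NNReal.coe_one, mul_one, mul_assoc,
    ← Real.exp_add]
  congr 2
  ring

/-- By `|x y| / 4 ≤ x² / 8 + y² / 8`, the integrand is dominated by a product of one-variable
functions integrable against the Gaussian. It dominates the block integrands for all small `r` at
once. -/
theorem integrable_exp_sum_abs_mul :
    Integrable (fun q : (ι → ℝ) × (ι → ℝ) => Real.exp (1 / 4 * ∑ e, |q.1 e * q.2 e|))
      ((stdGaussianPi ι).prod (stdGaussianPi ι)) := by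
  have h : Integrable (fun x : ι → ℝ => ∏ e, Real.exp (x e ^ 2 / 8)) (stdGaussianPi ι) :=
    Integrable.fintype_prod (f := fun _ x => Real.exp (x ^ 2 / 8))
      fun _ => integrable_exp_sq_div_eight
  refine (h.mul_prod h).mono' (by fun_prop) (ae_of_all _ fun q => ?_)
  rw [Real.norm_of_nonneg (Real.exp_pos _).le, ← Real.exp_sum, ← Real.exp_sum, ← Real.exp_add,
    ← Finset.sum_add_distrib, Finset.mul_sum]
  refine Real.exp_le_exp.2 (Finset.sum_le_sum fun e _ => ?_)
  rw [abs_mul, ← sq_abs (q.1 e), ← sq_abs (q.2 e)]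
  nlinarith [sq_nonneg (|q.1 e| - |q.2 e|)]

end Density

/-! ### Functions odd in disjoint blocks of coordinates -/

section OddBlocks

theorem abs_sinh_le (u : ℝ) : |Real.sinh u| ≤ |u| * Real.exp |u| := by
  have key : ∀ v : ℝ, 0 ≤ v → Real.sinh v ≤ v * Real.exp v := fun v hv => by
    rw [Real.sinh_eq]
    have h1 : Real.exp (-v) = Real.exp v * Real.exp (-(2 * v)) := by
      rw [← Real.exp_add]; ring_nf
    have h2 := Real.add_one_le_exp (-(2 * v))
    rw [h1]
    nlinarith [Real.exp_pos v]
  rw [Real.abs_sinh]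
  exact key _ (abs_nonneg u)

/-- The hyperbolic sine vanishes at zero, which yields one factor `t` per block. Half of the
exponent `1/4` absorbs the linear factor `|s|`, the other half the exponential growth. -/
theorem abs_sinh_mul_le {t s : ℝ} (ht : 0 ≤ t) (ht8 : t ≤ 1 / 8) :
    |Real.sinh (t * s)| ≤ 8 * t * Real.exp (1 / 4 * |s|) := by
  have h1 := abs_sinh_le (t * s)
  rw [abs_mul t s, abs_of_nonneg ht] at h1
  have h2 : |s| / 8 ≤ Real.exp (|s| / 8) := by linarith [Real.add_one_le_exp (|s| / 8)]
  have h3 : Real.exp (t * |s|) ≤ Real.exp (|s| / 8) :=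
    Real.exp_le_exp.2 (by nlinarith [abs_nonneg s])
  calc |Real.sinh (t * s)| ≤ t * |s| * Real.exp (t * |s|) := h1
    _ = 8 * t * ((|s| / 8) * Real.exp (t * |s|)) := by ring
    _ ≤ 8 * t * (Real.exp (|s| / 8) * Real.exp (|s| / 8)) := by gcongr
    _ = 8 * t * Real.exp (1 / 4 * |s|) := by rw [← Real.exp_add]; ring_nf

variable {ι : Type*} [Fintype ι] [DecidableEq ι]

/-- Negate the coordinates in `S`. -/
def negOn (S : Finset ι) (x : ι → ℝ) : ι → ℝ := fun e => if e ∈ S then -x e else x e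

theorem measurePreserving_negOn (S : Finset ι) :
    MeasurePreserving (negOn S) (stdGaussianPi ι) (stdGaussianPi ι) := by
  convert! measurePreserving_signs (ι := ι) (fun e => if e ∈ S then -1 else 1)
    (fun e => by by_cases h : e ∈ S <;> simp [h]) using 1
  ext x e
  by_cases h : e ∈ S <;> simp [negOn, h]

/-- The integrand in the Mehler representation of `gaussianCorr r f`, after the dependence on the
first `n` blocks has been antisymmetrized. -/
noncomputable def blockIntegrand (f : (ι → ℝ) → ℝ) (C : ℕ → Finset ι) (c w t : ℝ) (n : ℕ)
    (q : (ι → ℝ) × (ι → ℝ)) : ℝ :=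
  f q.1 * f q.2 * (c * Real.exp (-(w * ∑ e, (q.1 e ^ 2 + q.2 e ^ 2)))) *
    (∏ l ∈ Finset.range n, Real.sinh (t * ∑ e ∈ C l, q.1 e * q.2 e)) *
    Real.exp (t * ∑ e ∈ ((Finset.range n).biUnion C)ᶜ, q.1 e * q.2 e)

theorem measurable_blockIntegrand {f : (ι → ℝ) → ℝ} (hf : Measurable f) (C : ℕ → Finset ι)
    (c w t : ℝ) (n : ℕ) : Measurable (blockIntegrand f C c w t n) := by
  unfold blockIntegrand
  have h1 : Measurable fun q : (ι → ℝ) × (ι → ℝ) => f q.1 := hf.comp measurable_fst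
  have h2 : Measurable fun q : (ι → ℝ) × (ι → ℝ) => f q.2 := hf.comp measurable_snd
  have h3 : Measurable fun q : (ι → ℝ) × (ι → ℝ) =>
      ∏ l ∈ Finset.range n, Real.sinh (t * ∑ e ∈ C l, q.1 e * q.2 e) :=
    Finset.measurable_prod _ fun l _ => Real.measurable_sinh.comp (by fun_prop)
  fun_prop

theorem abs_blockIntegrand_le {f : (ι → ℝ) → ℝ} (hb : ∀ x, |f x| ≤ 1) {C : ℕ → Finset ι}
    {m : ℕ} (hC : ∀ k < m, ∀ l < m, k ≠ l → Disjoint (C k) (C l)) {c w t : ℝ} (hc : 0 ≤ c)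
    (hw : 0 ≤ w) (ht : 0 ≤ t) (ht8 : t ≤ 1 / 8) {n : ℕ} (hn : n ≤ m)
    (q : (ι → ℝ) × (ι → ℝ)) :
    |blockIntegrand f C c w t n q| ≤
      c * (8 * t) ^ n * Real.exp (1 / 4 * ∑ e, |q.1 e * q.2 e|) := by
  set A := (Finset.range n).biUnion C with hA
  have hf : |f q.1 * f q.2| ≤ 1 := by
    rw [abs_mul]; exact mul_le_one₀ (hb _) (abs_nonneg _) (hb _)
  have hW : |c * Real.exp (-(w * ∑ e, (q.1 e ^ 2 + q.2 e ^ 2)))| ≤ c := by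
    rw [abs_of_nonneg (by positivity)]
    refine mul_le_of_le_one_right hc (Real.exp_le_one_iff.2 ?_)
    have : 0 ≤ ∑ e, (q.1 e ^ 2 + q.2 e ^ 2) := Finset.sum_nonneg fun e _ => by positivity
    nlinarith
  have hS : |∏ l ∈ Finset.range n, Real.sinh (t * ∑ e ∈ C l, q.1 e * q.2 e)| ≤
      (8 * t) ^ n * Real.exp (1 / 4 * ∑ e ∈ A, |q.1 e * q.2 e|) := by
    rw [Finset.abs_prod, hA, Finset.sum_biUnion, Finset.mul_sum, Real.exp_sum]
    · calc
        _ ≤ ∏ l ∈ Finset.range n, (8 * t) * Real.exp (1 / 4 * ∑ e ∈ C l, |q.1 e * q.2 e|) := by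
          refine Finset.prod_le_prod (fun _ _ => abs_nonneg _) fun l _ => ?_
          refine (abs_sinh_mul_le ht ht8).trans ?_
          gcongr
          exact Finset.abs_sum_le_sum_abs _ _
        _ = _ := by rw [Finset.prod_mul_distrib, Finset.prod_const, Finset.card_range]
    · intro k hk l hl hkl
      exact hC k ((Finset.mem_range.1 hk).trans_le hn) l ((Finset.mem_range.1 hl).trans_le hn) hkl
  have hR : |Real.exp (t * ∑ e ∈ Aᶜ, q.1 e * q.2 e)| ≤
      Real.exp (1 / 4 * ∑ e ∈ Aᶜ, |q.1 e * q.2 e|) := by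
    rw [abs_of_pos (Real.exp_pos _)]
    refine Real.exp_le_exp.2 ?_
    have h1 : ∑ e ∈ Aᶜ, q.1 e * q.2 e ≤ ∑ e ∈ Aᶜ, |q.1 e * q.2 e| :=
      Finset.sum_le_sum fun e _ => le_abs_self _
    have h2 : 0 ≤ ∑ e ∈ Aᶜ, |q.1 e * q.2 e| := Finset.sum_nonneg fun e _ => abs_nonneg _
    nlinarith
  calc |blockIntegrand f C c w t n q| ≤ 1 * c *
        ((8 * t) ^ n * Real.exp (1 / 4 * ∑ e ∈ A, |q.1 e * q.2 e|)) *
        Real.exp (1 / 4 * ∑ e ∈ Aᶜ, |q.1 e * q.2 e|) := by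
        unfold blockIntegrand
        rw [abs_mul, abs_mul, abs_mul]
        gcongr
    _ = c * (8 * t) ^ n * (Real.exp (1 / 4 * ∑ e ∈ A, |q.1 e * q.2 e|) *
        Real.exp (1 / 4 * ∑ e ∈ Aᶜ, |q.1 e * q.2 e|)) := by ring
    _ = _ := by rw [← Real.exp_add, ← mul_add, Finset.sum_add_sum_compl]

theorem integrable_blockIntegrand {f : (ι → ℝ) → ℝ} (hf : Measurable f) (hb : ∀ x, |f x| ≤ 1)
    {C : ℕ → Finset ι} {m : ℕ} (hC : ∀ k < m, ∀ l < m, k ≠ l → Disjoint (C k) (C l))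
    {c w t : ℝ} (hc : 0 ≤ c) (hw : 0 ≤ w) (ht : 0 ≤ t) (ht8 : t ≤ 1 / 8) {n : ℕ} (hn : n ≤ m) :
    Integrable (blockIntegrand f C c w t n) ((stdGaussianPi ι).prod (stdGaussianPi ι)) :=
  (integrable_exp_sum_abs_mul.const_mul (c * (8 * t) ^ n)).mono'
    (measurable_blockIntegrand hf C c w t n).aestronglyMeasurable
    (ae_of_all _ fun q => abs_blockIntegrand_le hb hC hc hw ht ht8 hn q)

/-- Negating block `n` in the first vector alone preserves the measure and changes the sign of both
`f q.1` and the inner product over that block. Averaging the two integrands replaces the block's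
exponential by its odd part, a hyperbolic sine. -/
theorem integral_blockIntegrand_succ {f : (ι → ℝ) → ℝ} (hf : Measurable f) (hb : ∀ x, |f x| ≤ 1)
    {C : ℕ → Finset ι} {m : ℕ} (hC : ∀ k < m, ∀ l < m, k ≠ l → Disjoint (C k) (C l))
    (hodd : ∀ l < m, ∀ x, f (negOn (C l) x) = -f x)
    {c w t : ℝ} (hc : 0 ≤ c) (hw : 0 ≤ w) (ht : 0 ≤ t) (ht8 : t ≤ 1 / 8) {n : ℕ} (hn : n < m) :
    ∫ q, blockIntegrand f C c w t (n + 1) q ∂((stdGaussianPi ι).prod (stdGaussianPi ι)) =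
      ∫ q, blockIntegrand f C c w t n q ∂((stdGaussianPi ι).prod (stdGaussianPi ι)) := by
  set Γ := (stdGaussianPi ι).prod (stdGaussianPi ι)
  set T : (ι → ℝ) × (ι → ℝ) → (ι → ℝ) × (ι → ℝ) := Prod.map (negOn (C n)) id with hT
  have hTm : MeasurePreserving T Γ Γ :=
    (measurePreserving_negOn (C n)).prod (MeasurePreserving.id _)
  have hint := integrable_blockIntegrand hf hb hC hc hw ht ht8 hn.le
  have hintT : Integrable (fun q => blockIntegrand f C c w t n (T q)) Γ :=
    hTm.integrable_comp_of_integrable hint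
  have hTi : ∫ q, blockIntegrand f C c w t n (T q) ∂Γ = ∫ q, blockIntegrand f C c w t n q ∂Γ := by
    have h := integral_map hTm.measurable.aemeasurable
      (measurable_blockIntegrand hf C c w t n).aestronglyMeasurable (μ := Γ)
    rw [hTm.map_eq] at h
    exact h.symm
  have hd : ∀ l < n, Disjoint (C l) (C n) := fun l hl => hC l (hl.trans hn) n hn hl.ne
  have key : ∀ q, blockIntegrand f C c w t (n + 1) q =
      1 / 2 * (blockIntegrand f C c w t n q + blockIntegrand f C c w t n (T q)) := by
    intro q
    have hsub : C n ⊆ ((Finset.range n).biUnion C)ᶜ := fun e he => by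
      simp only [Finset.mem_compl, Finset.mem_biUnion, Finset.mem_range, not_exists, not_and]
      exact fun l hl h => Finset.disjoint_left.1 (hd l hl) h he
    have hset : ((Finset.range (n + 1)).biUnion C)ᶜ = ((Finset.range n).biUnion C)ᶜ \ C n := by
      ext e
      simp only [Finset.mem_compl, Finset.mem_biUnion, Finset.mem_range, Finset.mem_sdiff,
        Order.lt_add_one_iff, not_exists, not_and]
      constructor
      · exact fun h => ⟨fun l hl => h l hl.le, h n le_rfl⟩
      · rintro ⟨h1, h2⟩ l hl
        rcases hl.lt_or_eq with h | rfl
        exacts [h1 l h, h2]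
    have hsum : ∀ g : ι → ℝ, ∑ e ∈ ((Finset.range n).biUnion C)ᶜ, g e =
        ∑ e ∈ ((Finset.range (n + 1)).biUnion C)ᶜ, g e + ∑ e ∈ C n, g e := fun g => by
      rw [hset, Finset.sum_sdiff hsub]
    have hin : ∑ e ∈ C n, (T q).1 e * (T q).2 e = -∑ e ∈ C n, q.1 e * q.2 e := by
      rw [← Finset.sum_neg_distrib]
      refine Finset.sum_congr rfl fun e he => ?_
      simp [hT, negOn, he]
    have hout : ∀ S : Finset ι, Disjoint S (C n) →
        ∑ e ∈ S, (T q).1 e * (T q).2 e = ∑ e ∈ S, q.1 e * q.2 e := fun S hS => by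
      refine Finset.sum_congr rfl fun e he => ?_
      simp [hT, negOn, Finset.disjoint_left.1 hS he]
    have hrest : Disjoint ((Finset.range (n + 1)).biUnion C)ᶜ (C n) := by
      rw [hset]; exact Finset.sdiff_disjoint
    have hsq : ∑ e, ((T q).1 e ^ 2 + (T q).2 e ^ 2) = ∑ e, (q.1 e ^ 2 + q.2 e ^ 2) := by
      refine Finset.sum_congr rfl fun e _ => ?_
      by_cases h : e ∈ C n <;> simp [hT, negOn, h]
    have hprod : ∏ l ∈ Finset.range n, Real.sinh (t * ∑ e ∈ C l, (T q).1 e * (T q).2 e) =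
        ∏ l ∈ Finset.range n, Real.sinh (t * ∑ e ∈ C l, q.1 e * q.2 e) :=
      Finset.prod_congr rfl fun l hl => by rw [hout _ (hd l (Finset.mem_range.1 hl))]
    have hf1 : f (T q).1 = -f q.1 := hodd n hn q.1
    have hf2 : f (T q).2 = f q.2 := rfl
    unfold blockIntegrand
    rw [hprod, hsq, hf1, hf2, hsum, hsum (fun e => (T q).1 e * (T q).2 e), hin, hout _ hrest,
      Finset.prod_range_succ, Real.sinh_eq, mul_add t, mul_add t, Real.exp_add, Real.exp_add,
      mul_neg]
    ring
  simp only [key]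
  rw [integral_const_mul, integral_add hint hintT, hTi]
  ring

/-- Oddness in `m` disjoint blocks of coordinates makes the correlation small of order `m`. -/
theorem exists_gaussianCorr_le_mul_pow {f : (ι → ℝ) → ℝ} (hf : Measurable f)
    (hb : ∀ x, |f x| ≤ 1) {C : ℕ → Finset ι} {m : ℕ}
    (hC : ∀ k < m, ∀ l < m, k ≠ l → Disjoint (C k) (C l))
    (hodd : ∀ l < m, ∀ x, f (negOn (C l) x) = -f x) :
    ∃ K : ℝ, 0 < K ∧ ∀ r : ℝ, 0 < r → r ≤ 1 / 16 → gaussianCorr r f ≤ K * r ^ m := by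
  set Γ := (stdGaussianPi ι).prod (stdGaussianPi ι) with hΓ
  set M := ∫ q : (ι → ℝ) × (ι → ℝ), Real.exp (1 / 4 * ∑ e, |q.1 e * q.2 e|) ∂Γ with hM
  have hM0 : 0 ≤ M := integral_nonneg fun q => (Real.exp_pos _).le
  -- The power of 2 bounds the normalization `c` of the kernel, and `16 ^ m` comes from `8 t ≤ 16 r`
  -- in each block. The dependence on the dimension is harmless, as `gaussianCorr_le_pow` eliminates
  -- this constant.
  refine ⟨2 ^ Fintype.card ι * 16 ^ m * M + 1, by positivity, fun r h0 h1 => ?_⟩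
  have hr2 : r ^ 2 ≤ 1 / 4 := by nlinarith
  have hr1 : r ^ 2 < 1 := by linarith
  have hpos : 0 < 1 - r ^ 2 := by linarith
  set c := (√(1 - r ^ 2))⁻¹ ^ Fintype.card ι with hc
  set w := r ^ 2 / (2 * (1 - r ^ 2)) with hw
  set t := r / (1 - r ^ 2) with ht
  have hc0 : 0 ≤ c := by positivity
  have hw0 : 0 ≤ w := by positivity
  have ht0 : 0 ≤ t := by positivity
  have ht2 : t ≤ 2 * r := by
    rw [ht, div_le_iff₀ hpos]; nlinarith
  have ht8 : t ≤ 1 / 8 := by linarith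
  have hc2 : c ≤ 2 ^ Fintype.card ι := by
    refine pow_le_pow_left₀ (by positivity) ?_ _
    rw [inv_le_comm₀ (Real.sqrt_pos.2 hpos) two_pos]
    exact Real.le_sqrt_of_sq_le (by norm_num; linarith)
  have hI : ∀ n ≤ m, ∫ q, blockIntegrand f C c w t n q ∂Γ = gaussianCorr r f := by
    intro n
    induction n with
    | zero =>
      intro hn
      have hint := integrable_blockIntegrand hf hb hC hc0 hw0 ht0 ht8 hn
      rw [hΓ, integral_prod _ hint]
      unfold gaussianCorr
      refine integral_congr_ae (ae_of_all _ fun x => ?_)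
      simp only
      rw [integral_affine_eq hr1 hf, ← integral_const_mul]
      refine integral_congr_ae (ae_of_all _ fun y => ?_)
      simp only [blockIntegrand, mehlerKernel, Finset.range_zero, Finset.prod_empty,
        Finset.biUnion_empty, Finset.compl_empty, Finset.prod_mul_distrib, ← Real.exp_sum,
        Finset.prod_const, Finset.card_univ, Finset.sum_add_distrib, Finset.sum_neg_distrib,
        ← Finset.mul_sum, Real.exp_add]
      rw [← hc, ← hw, ← ht]
      ring
    | succ n ih =>
      intro hn
      rw [integral_blockIntegrand_succ hf hb hC hodd hc0 hw0 ht0 ht8 (by omega), ih (by omega)]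
  rw [← hI m le_rfl]
  calc ∫ q, blockIntegrand f C c w t m q ∂Γ
      ≤ ∫ q : (ι → ℝ) × (ι → ℝ),
          c * (8 * t) ^ m * Real.exp (1 / 4 * ∑ e, |q.1 e * q.2 e|) ∂Γ :=
        integral_mono (integrable_blockIntegrand hf hb hC hc0 hw0 ht0 ht8 le_rfl)
          (integrable_exp_sum_abs_mul.const_mul _) fun q =>
            (le_abs_self _).trans (abs_blockIntegrand_le hb hC hc0 hw0 ht0 ht8 le_rfl q)
    _ = c * (8 * t) ^ m * M := by rw [integral_const_mul]
    _ ≤ 2 ^ Fintype.card ι * (16 * r) ^ m * M := by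
        have : 8 * t ≤ 16 * r := by linarith
        gcongr
    _ ≤ (2 ^ Fintype.card ι * 16 ^ m * M + 1) * r ^ m := by
        rw [mul_pow]
        have : 0 ≤ r ^ m := by positivity
        nlinarith

/-- **Decay of correlations under Gaussian noise.** A bounded function which is odd in each of `m`
disjoint blocks of coordinates has noise correlation at most `ρ ^ m`. -/
theorem gaussianCorr_le_pow {f : (ι → ℝ) → ℝ} (hf : Measurable f) (hb : ∀ x, |f x| ≤ 1)
    {C : ℕ → Finset ι} {m : ℕ} (hC : ∀ k < m, ∀ l < m, k ≠ l → Disjoint (C k) (C l))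
    (hodd : ∀ l < m, ∀ x, f (negOn (C l) x) = -f x) {ρ : ℝ} (h0 : 0 < ρ) (h1 : ρ < 1) :
    gaussianCorr ρ f ≤ ρ ^ m := by
  obtain ⟨K, hK, hKr⟩ := exists_gaussianCorr_le_mul_pow hf hb hC hodd
  rcases le_or_gt (gaussianCorr ρ f) 0 with hneg | hpos
  · exact hneg.trans (by positivity)
  have hiter : ∀ k : ℕ, gaussianCorr ρ f ^ 2 ^ k ≤ gaussianCorr (ρ ^ 2 ^ k) f := by
    intro k
    induction k with
    | zero => simp
    | succ k ih =>
      rw [pow_succ, pow_mul, pow_mul]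
      refine (pow_le_pow_left₀ (by positivity) ih 2).trans ?_
      exact gaussianCorr_sq_le (by positivity) (pow_lt_one₀ h0.le h1 (by positivity)) hf hb
  -- If the correlation were `q ρ ^ m` with `q > 1`, the iterated inequality and the bound at the
  -- tiny parameter `ρ ^ (2 ^ k)` would give `q ^ (2 ^ k) ≤ K` for all large `k`.
  by_contra! hlt
  have hq : 1 < gaussianCorr ρ f / ρ ^ m := by
    rwa [one_lt_div (by positivity)]
  have htend : Filter.Tendsto (fun k : ℕ => 2 ^ k) Filter.atTop (Filter.atTop : Filter ℕ) :=
    tendsto_pow_atTop_atTop_of_one_lt one_lt_two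
  have hbig := ((tendsto_pow_atTop_atTop_of_one_lt hq).comp htend).eventually_gt_atTop K
  have hsmall := ((tendsto_pow_atTop_nhds_zero_of_lt_one h0.le h1).comp htend).eventually_le_const
    (show (0 : ℝ) < 1 / 16 by norm_num)
  obtain ⟨k, hk1, hk2⟩ := (hbig.and hsmall).exists
  simp only [Function.comp] at hk1 hk2
  have h := (hiter k).trans (hKr _ (by positivity) hk2)
  rw [div_pow, lt_div_iff₀ (by positivity)] at hk1
  rw [← pow_mul, mul_comm (2 ^ k) m, pow_mul] at h
  linarith

end OddBlocks

set_option linter.unusedSectionVars false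

/-! ### Gauge transformations and ground states -/

section Spins

variable {V : Type*}

/-- The product `σ_i σ_j` over the end points of the pair `e = {i, j}`. -/
def edgeSpin (σ : V → ℤˣ) (e : Sym2 V) : ℤˣ := (e.map σ).mul

theorem edgeSpin_mk (σ : V → ℤˣ) (a b : V) : edgeSpin σ s(a, b) = σ a * σ b := rfl

theorem edgeSpin_mul (g σ : V → ℤˣ) (e : Sym2 V) :
    edgeSpin (g * σ) e = edgeSpin g e * edgeSpin σ e := by
  induction e with | _ a b => simp only [edgeSpin_mk, Pi.mul_apply, mul_mul_mul_comm]

variable [Fintype V] [DecidableEq V] (G : SimpleGraph V) [DecidableRel G.Adj]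

theorem hamiltonian_eq (J : G.edgeSet → ℝ) (σ : V → ℤˣ) :
    hamiltonian G J σ = -∑ e : G.edgeSet, J e * ((edgeSpin σ e : ℤ) : ℝ) := rfl

theorem measurable_hamiltonian (σ : V → ℤˣ) : Measurable fun J => hamiltonian G J σ := by
  unfold hamiltonian; fun_prop

/-- The action of a gauge transformation on the couplings. -/
def gaugeCouplings (g : V → ℤˣ) (J : G.edgeSet → ℝ) : G.edgeSet → ℝ :=
  fun e => ((edgeSpin g e : ℤ) : ℝ) * J e

theorem hamiltonian_gauge (g : V → ℤˣ) (J : G.edgeSet → ℝ) (σ : V → ℤˣ) :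
    hamiltonian G (gaugeCouplings G g J) (g * σ) = hamiltonian G J σ := by
  simp only [hamiltonian_eq, gaugeCouplings, edgeSpin_mul]
  congr 1
  refine Finset.sum_congr rfl fun e _ => ?_
  rcases Int.units_eq_one_or (edgeSpin g e) with h | h <;> simp [h]

variable {G} {B : Finset V} {τ : B → ℤˣ}

/-- Multiplication by `g` is an energy-preserving involution between the two environments, and it
respects the boundary condition because `g` is trivial on `B`. -/
theorem IsGroundState.gauge {J : G.edgeSet → ℝ} {σ : V → ℤˣ} (h : IsGroundState G B τ J σ)
    {g : V → ℤˣ} (hg : ∀ i ∈ B, g i = 1) :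
    IsGroundState G B τ (gaugeCouplings G g J) (g * σ) := by
  refine ⟨fun i => by simp [hg i i.2, h.1 i], fun σ' hσ' => ?_⟩
  have hgg : g * (g * σ') = σ' := by
    ext1 i; simp [← mul_assoc, Int.units_mul_self]
  rw [hamiltonian_gauge, ← hgg, hamiltonian_gauge]
  exact h.2 _ fun i => by simp [hg i i.2, hσ' i]

theorem gaugeCouplings_gaugeCouplings (g : V → ℤˣ) (J : G.edgeSet → ℝ) :
    gaugeCouplings G g (gaugeCouplings G g J) = J := by
  ext e
  rcases Int.units_eq_one_or (edgeSpin g e) with h | h <;> simp [gaugeCouplings, h]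

theorem exists_isGroundState (J : G.edgeSet → ℝ) : ∃ σ, IsGroundState G B τ J σ := by
  classical
  obtain ⟨σ, hσ, hmin⟩ := Finset.exists_min_image
    (Finset.univ.filter fun σ : V → ℤˣ => ∀ i : B, σ i = τ i) (hamiltonian G J)
    ⟨fun i => if h : i ∈ B then τ ⟨i, h⟩ else 1, by
      simp only [Finset.mem_filter, Finset.mem_univ, true_and]
      exact fun i => dif_pos i.2⟩
  simp only [Finset.mem_filter, Finset.mem_univ, true_and] at hσ hmin
  exact ⟨σ, hσ, hmin⟩

theorem measurableSet_isGroundState (σ : V → ℤˣ) :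
    MeasurableSet {J : G.edgeSet → ℝ | IsGroundState G B τ J σ} := by
  have h : {J : G.edgeSet → ℝ | IsGroundState G B τ J σ} =
      {_J : G.edgeSet → ℝ | ∀ i : B, σ i = τ i} ∩
        ⋂ σ' : V → ℤˣ, {J | (∀ i : B, σ' i = τ i) → hamiltonian G J σ ≤ hamiltonian G J σ'} := by
    ext J; simp [IsGroundState]
  rw [h]
  refine (MeasurableSet.const _).inter (MeasurableSet.iInter fun σ' => ?_)
  by_cases hσ' : ∀ i : B, σ' i = τ i
  · simpa only [hσ', implies_true, true_imp_iff] using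
      measurableSet_le (measurable_hamiltonian G σ) (measurable_hamiltonian G σ')
  · have : {J : G.edgeSet → ℝ | (∀ i : B, σ' i = τ i) →
        hamiltonian G J σ ≤ hamiltonian G J σ'} = Set.univ := by
      ext J; simp only [Set.mem_univ, iff_true]; exact fun h => absurd h hσ'
    rw [this]; exact MeasurableSet.univ

end Spins

/-! ### Decay of the noise correlation of ground state spin products -/

section GroundCorr

variable {V : Type*} [Fintype V] [DecidableEq V] (G : SimpleGraph V) [DecidableRel G.Adj]
  (B : Finset V) (τ : B → ℤˣ)

/-- The couplings for which some ground state has `σ_i σ_j = s`. -/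
def groundSpinSet (i j : V) (s : ℤˣ) : Set (G.edgeSet → ℝ) :=
  {J | ∃ σ, IsGroundState G B τ J σ ∧ σ i * σ j = s}

/-- The value of `σ_i σ_j` in the ground state (`0` if it depends on the ground state). -/
noncomputable def groundCorr (i j : V) (J : G.edgeSet → ℝ) : ℝ :=
  (groundSpinSet G B τ i j 1).indicator 1 J - (groundSpinSet G B τ i j (-1)).indicator 1 J

theorem measurableSet_groundSpinSet (i j : V) (s : ℤˣ) :
    MeasurableSet (groundSpinSet G B τ i j s) := by
  have h : groundSpinSet G B τ i j s =
      ⋃ σ : V → ℤˣ, {J | IsGroundState G B τ J σ} ∩ {_J | σ i * σ j = s} := by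
    ext J; simp [groundSpinSet]
  rw [h]
  exact MeasurableSet.iUnion fun σ => (measurableSet_isGroundState σ).inter (MeasurableSet.const _)

theorem measurable_groundCorr (i j : V) : Measurable (groundCorr G B τ i j) :=
  (measurable_one.indicator (measurableSet_groundSpinSet G B τ i j 1)).sub
    (measurable_one.indicator (measurableSet_groundSpinSet G B τ i j (-1)))

theorem abs_groundCorr_le (i j : V) (J : G.edgeSet → ℝ) : |groundCorr G B τ i j J| ≤ 1 := by
  unfold groundCorr
  by_cases h1 : J ∈ groundSpinSet G B τ i j 1 <;>
    by_cases h2 : J ∈ groundSpinSet G B τ i j (-1) <;> simp [h1, h2]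

theorem groundCorr_comm (i j : V) : groundCorr G B τ i j = groundCorr G B τ j i := by
  ext J
  simp only [groundCorr, groundSpinSet, mul_comm]

variable {G B τ}

/-- Since `groundCorr` does not select a ground state, the oddness is exact for every `J`, including
those with degenerate ground states. -/
theorem groundCorr_gauge {i j : V} {g : V → ℤˣ} (hg : ∀ k ∈ B, g k = 1) (hij : g i * g j = -1)
    (J : G.edgeSet → ℝ) :
    groundCorr G B τ i j (gaugeCouplings G g J) = -groundCorr G B τ i j J := by
  have hsub : ∀ (s : ℤˣ) (J : G.edgeSet → ℝ), J ∈ groundSpinSet G B τ i j s →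
      gaugeCouplings G g J ∈ groundSpinSet G B τ i j (-s) := by
    rintro s J ⟨σ, hσ, hs⟩
    refine ⟨g * σ, hσ.gauge hg, ?_⟩
    rw [Pi.mul_apply, Pi.mul_apply, mul_mul_mul_comm, hij, hs, neg_one_mul]
  have hiff : ∀ s : ℤˣ, gaugeCouplings G g J ∈ groundSpinSet G B τ i j s ↔
      J ∈ groundSpinSet G B τ i j (-s) := fun s =>
    ⟨fun h => by simpa [gaugeCouplings_gaugeCouplings] using hsub _ _ h,
      fun h => by simpa using hsub _ _ h⟩
  have hind : ∀ s : ℤˣ, (groundSpinSet G B τ i j s).indicator (1 : (G.edgeSet → ℝ) → ℝ)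
      (gaugeCouplings G g J) = (groundSpinSet G B τ i j (-s)).indicator 1 J := fun s => by
    classical
    rw [Set.indicator_apply, Set.indicator_apply, Pi.one_apply, Pi.one_apply]
    exact if_congr (hiff s) rfl rfl
  unfold groundCorr
  rw [hind, hind, neg_neg, neg_sub]

/-- The gauge transformation which flips the ball of radius `l` around `c`. -/
noncomputable def ballGauge (G : SimpleGraph V) (c : V) (l : ℕ) : V → ℤˣ :=
  fun v => if G.dist c v ≤ l then -1 else 1

/-- The edges which leave the ball of radius `l` around `c`. -/
noncomputable def sphereCut (G : SimpleGraph V) [DecidableRel G.Adj] (c : V) (l : ℕ) :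
    Finset G.edgeSet :=
  Finset.univ.filter fun e => edgeSpin (ballGauge G c l) e = -1

theorem negOn_sphereCut (c : V) (l : ℕ) (J : G.edgeSet → ℝ) :
    negOn (sphereCut G c l) J = gaugeCouplings G (ballGauge G c l) J := by
  ext e
  rcases Int.units_eq_one_or (edgeSpin (ballGauge G c l) e) with h | h <;>
    simp [negOn, sphereCut, gaugeCouplings, h]

/-- The distances of two adjacent vertices from `c` differ by at most one, so an edge leaves the
ball of at most one radius. -/
theorem disjoint_sphereCut (hG : G.Connected) (c : V) {k l : ℕ} (hkl : k ≠ l) :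
    Disjoint (sphereCut G c k) (sphereCut G c l) := by
  rw [Finset.disjoint_left]
  rintro ⟨e, he⟩ hk hl
  induction e with | _ a b => ?_
  have hab : G.dist a b = 1 := SimpleGraph.dist_eq_one_iff_adj.2 he
  have h1 := hG.dist_triangle (u := c) (v := a) (w := b)
  have h2 := hG.dist_triangle (u := c) (v := b) (w := a)
  rw [SimpleGraph.dist_comm (u := b)] at h2
  simp only [sphereCut, Finset.mem_filter, Finset.mem_univ, true_and, edgeSpin_mk,
    ballGauge] at hk hl
  split_ifs at hk hl <;> first | omega | simp_all

/-- The blocks are the cuts of radii `l < m` around `i`: these balls contain `i`, but neither `j`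
nor a point of `B`. -/
theorem gaussianCorr_groundCorr_le (hG : G.Connected) {i j : V} {m : ℕ} (hj : m ≤ G.dist i j)
    (hB : ∀ k ∈ B, m ≤ G.dist i k) {ρ : ℝ} (h0 : 0 < ρ) (h1 : ρ < 1) :
    gaussianCorr ρ (groundCorr G B τ i j) ≤ ρ ^ m := by
  refine gaussianCorr_le_pow (measurable_groundCorr G B τ i j) (abs_groundCorr_le G B τ i j)
    (C := sphereCut G i) (fun k _ l _ h => disjoint_sphereCut hG i h) (fun l hl J => ?_) h0 h1
  rw [negOn_sphereCut]
  refine groundCorr_gauge (fun k hk => ?_) ?_ J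
  · exact if_neg (by have := hB k hk; omega)
  · simp [ballGauge, show ¬ G.dist i j ≤ l by omega]

/-- The decay `ρ ^ (d / 2)` in the distance `d` from `i` to `B`, which is `0` if `B` is empty. -/
noncomputable def boundaryDecay (G : SimpleGraph V) (B : Finset V) (ρ : ℝ) (i : V) : ℝ :=
  if h : B.Nonempty then √ρ ^ B.inf' h (fun k => G.dist i k) else 0

theorem boundaryDecay_nonneg (ρ : ℝ) (i : V) : 0 ≤ boundaryDecay G B ρ i := by
  unfold boundaryDecay; split_ifs <;> positivity

/-- If `d(i, j)` is at most the distance of `i` or `j` to `B`, centring the balls at that vertex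
gives the first term. Otherwise either centre is limited by its distance to `B`, and the larger of
these distances is at least their average. The product form lets the double sum over `i, j` factor.
-/
theorem gaussianCorr_groundCorr_le_add (hG : G.Connected) (i j : V) {ρ : ℝ} (h0 : 0 < ρ)
    (h1 : ρ < 1) :
    gaussianCorr ρ (groundCorr G B τ i j) ≤
      ρ ^ G.dist i j + boundaryDecay G B ρ i * boundaryDecay G B ρ j := by
  have hnn := mul_nonneg (boundaryDecay_nonneg (G := G) (B := B) ρ i)
    (boundaryDecay_nonneg (G := G) (B := B) ρ j)
  have hd0 : 0 ≤ ρ ^ G.dist i j := by positivity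
  by_cases hB : B.Nonempty
  swap
  · rw [Finset.not_nonempty_iff_eq_empty] at hB
    have := gaussianCorr_groundCorr_le (B := B) (τ := τ) hG (le_refl (G.dist i j))
      (by simp [hB]) h0 h1
    linarith
  have hi : ∀ k ∈ B, B.inf' hB (fun k => G.dist i k) ≤ G.dist i k := fun k hk =>
    Finset.inf'_le _ hk
  have hj : ∀ k ∈ B, B.inf' hB (fun k => G.dist j k) ≤ G.dist j k := fun k hk =>
    Finset.inf'_le _ hk
  simp only [boundaryDecay, hB, dite_true] at hnn ⊢
  set bi := B.inf' hB (fun k => G.dist i k)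
  set bj := B.inf' hB (fun k => G.dist j k)
  by_cases hdi : G.dist i j ≤ bi
  · have := gaussianCorr_groundCorr_le (B := B) (τ := τ) hG (le_refl (G.dist i j))
      (fun k hk => hdi.trans (hi k hk)) h0 h1
    linarith
  by_cases hdj : G.dist i j ≤ bj
  · have := gaussianCorr_groundCorr_le (B := B) (τ := τ) hG (G.dist_comm (u := i) (v := j)).le
      (fun k hk => hdj.trans (hj k hk)) h0 h1
    rw [groundCorr_comm] at this
    linarith
  have hi' := gaussianCorr_groundCorr_le (B := B) (τ := τ) hG (not_le.1 hdi).le hi h0 h1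
  have hj' := gaussianCorr_groundCorr_le (B := B) (τ := τ) hG
    ((not_le.1 hdj).le.trans (G.dist_comm (u := i) (v := j)).le) hj h0 h1
  rw [groundCorr_comm] at hj'
  have hs0 : 0 < √ρ := Real.sqrt_pos.2 h0
  have hs1 : √ρ ≤ 1 := Real.sqrt_le_one.2 h1.le
  have hs : ∀ b : ℕ, ρ ^ b = √ρ ^ (b + b) := fun b => by
    rw [← two_mul, pow_mul, Real.sq_sqrt h0.le]
  rw [hs] at hi' hj'
  rw [← pow_add]
  rcases le_total bi bj with h | h
  · have := pow_le_pow_of_le_one hs0.le hs1 (show bi + bj ≤ bj + bj by omega)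
    linarith
  · have := pow_le_pow_of_le_one hs0.le hs1 (show bi + bj ≤ bi + bi by omega)
    linarith

end GroundCorr

/-! ### Almost sure uniqueness of the ground state -/

section Uniqueness

/-- A nonzero linear form has a Gaussian law of positive variance, which has no atoms. -/
theorem ae_sum_mul_ne_zero {ι : Type*} [Fintype ι] {c : ι → ℝ} (hc : c ≠ 0) :
    ∀ᵐ x ∂(stdGaussianPi ι), ∑ e, c e * x e ≠ 0 := by
  obtain ⟨e₀, he₀⟩ := Function.ne_iff.1 hc
  let L : StrongDual ℝ (ι → ℝ) := ∑ e, c e • ContinuousLinearMap.proj e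
  have hL : ∀ x, L x = ∑ e, c e * x e := fun x => by simp [L]
  have hvar : Var[L; stdGaussianPi ι] = ∑ e, c e ^ 2 := by
    have h := variance_sum_pi (μ := fun _ : ι => gaussianReal 0 1) (X := fun e y => c e * y)
      (fun e => (memLp_id_gaussianReal 2).const_mul (c e))
    have hv : ∀ e, Var[fun y => c e * y; gaussianReal 0 1] = c e ^ 2 := fun e => by
      rw [variance_const_mul, variance_fun_id_gaussianReal, NNReal.coe_one, mul_one]
    simp only [hv] at h
    rw [← h]
    congr 1
    ext x
    simp [hL]
  have hpos : 0 < ∑ e, c e ^ 2 :=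
    Finset.sum_pos' (fun e _ => sq_nonneg _) ⟨e₀, Finset.mem_univ _, by
      have : c e₀ ≠ 0 := he₀
      positivity⟩
  have hmap := IsGaussian.map_eq_gaussianReal (μ := stdGaussianPi ι) L
  have hns : NullSingletonClass ((stdGaussianPi ι).map L) := by
    rw [hmap, hvar]
    exact nullSingletonClass_gaussianReal (by simpa using hpos)
  have h0 := hns.measure_singleton 0
  rw [Measure.map_apply L.continuous.measurable (MeasurableSet.singleton 0)] at h0
  rw [ae_iff]
  refine measure_mono_null (fun x hx => ?_) h0
  simp only [ne_eq, not_not, Set.mem_ofPred_eq] at hx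
  simp [hL, hx]

variable {V : Type*} [Fintype V] [DecidableEq V] {G : SimpleGraph V} [DecidableRel G.Adj]
  {B : Finset V} {τ : B → ℤˣ}

theorem mul_eq_mul_of_edgeSpin_eq (hG : G.Connected) {σ σ' : V → ℤˣ}
    (h : ∀ e : G.edgeSet, edgeSpin σ e = edgeSpin σ' e) (i j : V) : σ i * σ j = σ' i * σ' j := by
  have hadj : ∀ a b, G.Adj a b → σ a * σ b = σ' a * σ' b := fun a b hab => h ⟨s(a, b), hab⟩
  obtain ⟨w⟩ := hG.preconnected i j
  induction w with
  | nil => simp [Int.units_mul_self]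
  | cons hab _ ih =>
    rename_i a b c _
    have h1 : σ a * σ c = (σ a * σ b) * (σ b * σ c) := by
      rw [mul_assoc, ← mul_assoc (σ b), Int.units_mul_self, one_mul]
    have h2 : σ' a * σ' c = (σ' a * σ' b) * (σ' b * σ' c) := by
      rw [mul_assoc, ← mul_assoc (σ' b), Int.units_mul_self, one_mul]
    rw [h1, h2, ih, hadj _ _ hab]

/-- Almost surely, the ground state is unique up to a global sign. -/
theorem ae_groundState_unique (hG : G.Connected) :
    ∀ᵐ J ∂(stdGaussianPi G.edgeSet), ∀ σ σ', IsGroundState G B τ J σ → IsGroundState G B τ J σ' →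
      ∀ i j, σ i * σ j = σ' i * σ' j := by
  rw [ae_all_iff]; intro σ
  rw [ae_all_iff]; intro σ'
  -- Two configurations either agree in all edge products, hence by connectedness in all `σ_i σ_j`,
  -- or their energies differ by a nonzero linear form in `J`.
  by_cases hc : (fun e : G.edgeSet =>
      ((edgeSpin σ e : ℤ) : ℝ) - ((edgeSpin σ' e : ℤ) : ℝ)) = 0
  · refine ae_of_all _ fun J _ _ => mul_eq_mul_of_edgeSpin_eq hG fun e => ?_
    have := congrFun hc e
    simp only [Pi.zero_apply, sub_eq_zero] at this
    exact Units.ext (by exact_mod_cast this)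
  · filter_upwards [ae_sum_mul_ne_zero hc] with J hJ hσ hσ'
    refine absurd ?_ hJ
    have h := le_antisymm (hσ.2 σ' hσ'.1) (hσ'.2 σ hσ.1)
    simp only [hamiltonian_eq, neg_inj] at h
    simp only [sub_mul, Finset.sum_sub_distrib]
    rw [sub_eq_zero]
    simpa only [mul_comm] using h

theorem groundCorr_eq {J : G.edgeSet → ℝ} (hJ : ∀ σ σ', IsGroundState G B τ J σ →
      IsGroundState G B τ J σ' → ∀ i j, σ i * σ j = σ' i * σ' j)
    {σ : V → ℤˣ} (hσ : IsGroundState G B τ J σ) (i j : V) :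
    groundCorr G B τ i j J = ((σ i : ℤ) : ℝ) * ((σ j : ℤ) : ℝ) := by
  have hmem : ∀ s, J ∈ groundSpinSet G B τ i j s ↔ σ i * σ j = s := fun s =>
    ⟨fun ⟨σ', h, hs⟩ => (hJ σ σ' hσ h i j).trans hs, fun h => ⟨σ, hσ, h⟩⟩
  have hcast : ((σ i : ℤ) : ℝ) * ((σ j : ℤ) : ℝ) = (((σ i * σ j : ℤˣ) : ℤ) : ℝ) := by
    push_cast; rfl
  rw [hcast]
  rcases Int.units_eq_one_or (σ i * σ j) with h | h
  · have h1 : J ∈ groundSpinSet G B τ i j 1 := (hmem 1).2 h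
    have h2 : J ∉ groundSpinSet G B τ i j (-1) := fun h' => by
      rw [hmem, h] at h'; exact absurd h' (by decide)
    simp [groundCorr, h1, h2, h]
  · have h1 : J ∈ groundSpinSet G B τ i j (-1) := (hmem _).2 h
    have h2 : J ∉ groundSpinSet G B τ i j 1 := fun h' => by
      rw [hmem, h] at h'; exact absurd h' (by decide)
    simp [groundCorr, h1, h2, h]

end Uniqueness

/-! ### The disagreement set as a cheap interface -/

section Interface

variable {V : Type*} [Fintype V] [DecidableEq V] {G : SimpleGraph V} [DecidableRel G.Adj]
  {B : Finset V} {τ : B → ℤˣ}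

/-- The vertices at which two configurations differ. -/
def disagreement (σ σ' : V → ℤˣ) : Finset V := Finset.univ.filter fun i => σ i ≠ σ' i

theorem overturn_disagreement (σ σ' : V → ℤˣ) : overturn (disagreement σ σ') σ = σ' := by
  ext1 i
  by_cases h : σ i = σ' i
  · simp [overturn, disagreement, h]
  · rw [← Ne, Int.units_ne_iff_eq_neg] at h
    simp [overturn, disagreement, h]

theorem mem_edgeBoundary_of_edgeSpin_ne {σ σ' : V → ℤˣ} {e : G.edgeSet}
    (h : edgeSpin σ e ≠ edgeSpin σ' e) :
    (e : Sym2 V) ∈ edgeBoundary G (disagreement σ σ') := by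
  obtain ⟨e, he⟩ := e
  induction e with | _ a b => ?_
  simp only [edgeBoundary, Finset.mem_filter, SimpleGraph.mem_edgeFinset]
  refine ⟨he, ?_⟩
  simp only [edgeSpin_mk] at h
  by_cases ha : σ a = σ' a <;> by_cases hb : σ b = σ' b
  · simp [ha, hb] at h
  · exact ⟨b, by simp [disagreement, hb], a, by simp [disagreement, ha], Sym2.eq_swap⟩
  · exact ⟨a, by simp [disagreement, ha], b, by simp [disagreement, hb], rfl⟩
  · rw [← Ne, Int.units_ne_iff_eq_neg] at ha hb
    simp [ha, hb] at h

/-- If the couplings `J` and `J'` differ by at most `D`, then overturning, in the ground state of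
`J`, the spins at which it differs from the ground state of `J'` costs at most `2 D` per boundary
edge. -/
theorem energyCost_disagreement_le {J J' : G.edgeSet → ℝ} {σ σ' : V → ℤˣ} {D : ℝ}
    (hσ : IsGroundState G B τ J σ) (hσ' : IsGroundState G B τ J' σ')
    (hD : ∀ e, |J e - J' e| ≤ D) :
    energyCost G J σ (disagreement σ σ') ≤
      2 * D * (edgeBoundary G (disagreement σ σ')).card := by
  have h1 : hamiltonian G J' σ' ≤ hamiltonian G J' σ := hσ'.2 σ hσ.1
  -- The energy change from `σ` to `σ'` is nonpositive for `J'`, so subtracting it from the change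
  -- for `J` only increases the cost.
  have h2 : energyCost G J σ (disagreement σ σ') ≤
      ∑ e : G.edgeSet, (J e - J' e) * (((edgeSpin σ e : ℤ) : ℝ) - ((edgeSpin σ' e : ℤ) : ℝ)) := by
    rw [energyCost, overturn_disagreement]
    simp only [hamiltonian_eq, sub_mul, mul_sub, Finset.sum_sub_distrib] at h1 ⊢
    linarith
  refine h2.trans ?_
  calc _ ≤ ∑ e : G.edgeSet,
        if (e : Sym2 V) ∈ edgeBoundary G (disagreement σ σ') then 2 * D else 0 := by
        refine Finset.sum_le_sum fun e _ => ?_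
        by_cases h : edgeSpin σ e = edgeSpin σ' e
        · have hD0 : 0 ≤ D := (abs_nonneg _).trans (hD e)
          rw [h, sub_self, mul_zero]
          split_ifs <;> linarith
        · rw [if_pos (mem_edgeBoundary_of_edgeSpin_ne h)]
          have hs := hD e
          rw [abs_le] at hs
          rw [← Ne, Int.units_ne_iff_eq_neg] at h
          rcases Int.units_eq_one_or (edgeSpin σ' e) with h' | h' <;>
            rw [h, h'] <;> push_cast <;> linarith [hs.1, hs.2]
    _ = ∑ e ∈ G.edgeFinset,
        if e ∈ edgeBoundary G (disagreement σ σ') then 2 * D else 0 := by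
        rw [← Finset.sum_coe_sort G.edgeFinset]
        refine Fintype.sum_equiv (Equiv.subtypeEquivRight fun e => by simp) _ _ fun e => rfl
    _ = 2 * D * (edgeBoundary G (disagreement σ σ')).card := by
        rw [← Finset.sum_filter, Finset.sum_const, nsmul_eq_mul, mul_comm]
        congr 3
        ext e
        simp only [Finset.mem_filter, edgeBoundary]
        tauto

theorem disagreement_subset {σ σ' : V → ℤˣ} (hσ : ∀ i : B, σ i = τ i) (hσ' : ∀ i : B, σ' i = τ i) :
    disagreement σ σ' ⊆ Bᶜ := fun i hi => by
  simp only [disagreement, Finset.mem_filter, Finset.mem_univ, true_and] at hi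
  exact Finset.mem_compl.2 fun hB => hi ((hσ ⟨i, hB⟩).trans (hσ' ⟨i, hB⟩).symm)

theorem sum_mul_eq_card_sub {σ σ' : V → ℤˣ} (h : disagreement σ σ' ⊆ Bᶜ) :
    ∑ i ∈ Bᶜ, ((σ i : ℤ) : ℝ) * ((σ' i : ℤ) : ℝ) =
      (Bᶜ).card - 2 * (disagreement σ σ').card := by
  have hi : ∀ i, ((σ i : ℤ) : ℝ) * ((σ' i : ℤ) : ℝ) =
      1 - 2 * if i ∈ disagreement σ σ' then 1 else 0 := fun i => by
    by_cases h : σ i = σ' i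
    · rcases Int.units_eq_one_or (σ' i) with h' | h' <;> simp [disagreement, h, h']
    · have h2 := h
      rw [← Ne, Int.units_ne_iff_eq_neg] at h2
      rw [if_pos (by simp [disagreement, h]), h2]
      rcases Int.units_eq_one_or (σ' i) with h' | h' <;> rw [h'] <;> norm_num
  simp only [hi, Finset.sum_sub_distrib, ← Finset.mul_sum, Finset.sum_ite_mem,
    Finset.inter_eq_right.2 h, Finset.sum_const, nsmul_eq_mul, mul_one]

/-- The sum over `i, j ∉ B` of the products of the ground state correlations for `J` and `J'`. -/
noncomputable def overlapSq (G : SimpleGraph V) [DecidableRel G.Adj] (B : Finset V) (τ : B → ℤˣ)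
    (J J' : G.edgeSet → ℝ) : ℝ :=
  ∑ i ∈ Bᶜ, ∑ j ∈ Bᶜ, groundCorr G B τ i j J * groundCorr G B τ i j J'

/-- The summand factors as `(σ_i σ'_i) (σ_j σ'_j)`, so the double sum is the square of the overlap.
-/
theorem overlapSq_eq {J J' : G.edgeSet → ℝ} (hJ : ∀ σ σ', IsGroundState G B τ J σ →
      IsGroundState G B τ J σ' → ∀ i j, σ i * σ j = σ' i * σ' j)
    (hJ' : ∀ σ σ', IsGroundState G B τ J' σ →
      IsGroundState G B τ J' σ' → ∀ i j, σ i * σ j = σ' i * σ' j)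
    {σ σ' : V → ℤˣ} (hσ : IsGroundState G B τ J σ) (hσ' : IsGroundState G B τ J' σ') :
    overlapSq G B τ J J' = ((Bᶜ).card - 2 * (disagreement σ σ').card : ℝ) ^ 2 := by
  rw [← sum_mul_eq_card_sub (disagreement_subset hσ.1 hσ'.1), sq, Finset.sum_mul_sum]
  refine Finset.sum_congr rfl fun i _ => Finset.sum_congr rfl fun j _ => ?_
  rw [groundCorr_eq hJ hσ, groundCorr_eq hJ' hσ']
  ring

theorem minInterfaceRatio_lt {J J' : G.edgeSet → ℝ} (hJ : ∀ σ σ', IsGroundState G B τ J σ →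
      IsGroundState G B τ J σ' → ∀ i j, σ i * σ j = σ' i * σ' j)
    (hJ' : ∀ σ σ', IsGroundState G B τ J' σ →
      IsGroundState G B τ J' σ' → ∀ i j, σ i * σ j = σ' i * σ' j)
    {σ : V → ℤˣ} (hσ : IsGroundState G B τ J σ) {D t : ℝ} (hD : ∀ e, |J e - J' e| ≤ D)
    (ht : 0 < t) (hDt : 2 * D < t)
    (hov : overlapSq G B τ J J' < ((Bᶜ).card : ℝ) ^ 2 / 4) :
    minInterfaceRatio G B J σ < (t : WithTop ℝ) := by
  obtain ⟨σ', hσ'⟩ := exists_isGroundState (G := G) (B := B) (τ := τ) J'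
  rw [overlapSq_eq hJ hJ' hσ hσ'] at hov
  -- With `n = |V°|`, the condition `|n - 2 |A|| < n / 2` says exactly `n / 4 < |A| < 3 n / 4`.
  have hov' := abs_lt_of_sq_lt_sq (b := ((Bᶜ).card : ℝ) / 2) (hov.trans_eq (by ring))
    (by positivity)
  rw [abs_lt] at hov'
  have hmem : disagreement σ σ' ∈ midsizeRegions B := by
    simp only [midsizeRegions, Finset.mem_filter, Finset.mem_powerset]
    exact ⟨disagreement_subset hσ.1 hσ'.1, by linarith [hov'.1, hov'.2], by
      linarith [hov'.1, hov'.2]⟩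
  refine (Finset.inf_le hmem).trans_lt (WithTop.coe_lt_coe.2 ?_)
  have h := energyCost_disagreement_le hσ hσ' hD
  rcases Nat.eq_zero_or_pos (edgeBoundary G (disagreement σ σ')).card with h0 | h0
  · simpa [h0] using ht
  · refine lt_of_le_of_lt ?_ hDt
    rwa [div_le_iff₀ (by exact_mod_cast h0)]

/-- The couplings with a ground state for which `F ≥ t`. -/
def largeRatioSet (G : SimpleGraph V) [DecidableRel G.Adj] (B : Finset V) (τ : B → ℤˣ) (t : ℝ) :
    Set (G.edgeSet → ℝ) :=
  {J | ∃ σ, IsGroundState G B τ J σ ∧ (t : WithTop ℝ) ≤ minInterfaceRatio G B J σ}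

theorem measurableSet_largeRatioSet (t : ℝ) : MeasurableSet (largeRatioSet G B τ t) := by
  have h : largeRatioSet G B τ t = ⋃ σ : V → ℤˣ, {J | IsGroundState G B τ J σ} ∩
      ⋂ A ∈ midsizeRegions B, {J | t ≤ energyCost G J σ A / (edgeBoundary G A).card} := by
    ext J
    simp only [largeRatioSet, minInterfaceRatio, Finset.le_inf_iff, WithTop.coe_le_coe,
      Set.mem_ofPred_eq, Set.mem_iUnion, Set.mem_inter_iff, Set.mem_iInter]
  rw [h]
  refine MeasurableSet.iUnion fun σ => (measurableSet_isGroundState σ).inter <|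
    Finset.measurableSet_biInter _ fun A _ => measurableSet_le measurable_const ?_
  exact ((measurable_hamiltonian G _).sub (measurable_hamiltonian G _)).div_const _

end Interface

/-! ### Gaussian tail bounds -/

section Tails

theorem gaussianReal_abs_gt_le {L : ℝ} (hL : 0 ≤ L) :
    (gaussianReal 0 1).real {y | L < |y|} ≤ 2 * Real.exp (-L ^ 2 / 2) := by
  have hsub : HasSubgaussianMGF id 1 (gaussianReal 0 1) :=
    ⟨fun t => integrable_exp_mul_gaussianReal t, fun t => by
      rw [mgf_id_gaussianReal]; simp⟩
  have h1 := hsub.measure_ge_le hL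
  have h2 := hsub.neg.measure_ge_le hL
  simp only [NNReal.coe_one, mul_one, id, Pi.neg_apply] at h1 h2
  calc (gaussianReal 0 1).real {y | L < |y|}
      ≤ (gaussianReal 0 1).real ({y | L ≤ y} ∪ {y | L ≤ -y}) := by
        refine measureReal_mono fun y hy => ?_
        rcases lt_abs.1 (show L < |y| from hy) with h | h
        exacts [Or.inl h.le, Or.inr h.le]
    _ ≤ _ := measureReal_union_le _ _
    _ ≤ _ := by linarith

theorem stdGaussianPi_exists_abs_gt_le {ι : Type*} [Fintype ι] {L : ℝ} (hL : 0 ≤ L) :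
    (stdGaussianPi ι).real {x | ∃ e, L < |x e|} ≤
      Fintype.card ι * (2 * Real.exp (-L ^ 2 / 2)) := by
  have h : {x : ι → ℝ | ∃ e, L < |x e|} = ⋃ e, {x | L < |x e|} := by ext; simp
  rw [h]
  refine (measureReal_iUnion_fintype_le _).trans ?_
  calc _ ≤ ∑ _e : ι, 2 * Real.exp (-L ^ 2 / 2) := by
        refine Finset.sum_le_sum fun e _ => ?_
        have hm := (measurePreserving_eval (α := fun _ : ι => ℝ)
          (fun _ => gaussianReal 0 1) e).measureReal_preimage (s := {y | L < |y|})
          (measurableSet_lt measurable_const (by fun_prop)).nullMeasurableSet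
        exact hm.le.trans (gaussianReal_abs_gt_le hL)
    _ = _ := by simp

end Tails

/-! ### Exponential sums under polynomial growth -/

section LayerCake

theorem summable_succ_rpow_mul_exp_neg (κ : ℝ) :
    Summable fun k : ℕ => ((k : ℝ) + 1) ^ κ * Real.exp (-(k : ℝ)) := by
  have h := (summable_nat_add_iff 1).2 (Real.summable_pow_mul_exp_neg_nat_mul ⌈κ⌉₊ one_pos)
  refine (h.mul_left (Real.exp 1)).of_nonneg_of_le (fun k => by positivity) fun k => ?_
  have h1 : ((k : ℝ) + 1) ^ κ ≤ ((k : ℝ) + 1) ^ ⌈κ⌉₊ := by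
    rw [← Real.rpow_natCast]
    exact Real.rpow_le_rpow_of_exponent_le (by linarith [k.cast_nonneg (α := ℝ)]) (Nat.le_ceil κ)
  calc ((k : ℝ) + 1) ^ κ * Real.exp (-(k : ℝ))
      ≤ ((k : ℝ) + 1) ^ ⌈κ⌉₊ * Real.exp (-(k : ℝ)) := by gcongr
    _ = Real.exp 1 * ((((k + 1 : ℕ) : ℝ)) ^ ⌈κ⌉₊ * Real.exp (-1 * ((k + 1 : ℕ) : ℝ))) := by
        rw [mul_left_comm, ← Real.exp_add]
        push_cast
        ring_nf

/-- The constant `∑_k (k + 1)^κ e^{-k}`. -/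
noncomputable def growthConst (κ : ℝ) : ℝ := ∑' k : ℕ, ((k : ℝ) + 1) ^ κ * Real.exp (-(k : ℝ))

theorem growthConst_nonneg (κ : ℝ) : 0 ≤ growthConst κ :=
  tsum_nonneg fun k => by positivity

/-- Sort the points by `k = ⌊p D⌋`. Those with value `k` lie within radius `(k + 1) / p`, which is
at least 1 as `p ≤ 1`, so the growth bound applies, and `exp (-k)` makes the sum over `k` converge.
-/
theorem sum_exp_neg_le {V : Type*} [Fintype V] (D : V → ℕ) {K κ p : ℝ} (hK : 0 ≤ K)
    (h : ∀ r : ℝ, 1 ≤ r → ({j : V | (D j : ℝ) ≤ r}.ncard : ℝ) ≤ K * r ^ κ)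
    (hp : 0 < p) (hp1 : p ≤ 1) :
    ∑ j, Real.exp (-(p * D j)) ≤ K * p ^ (-κ) * growthConst κ := by
  classical
  set f : V → ℕ := fun j => ⌊p * D j⌋₊ with hf
  obtain ⟨M, hM⟩ : ∃ M, ∀ j ∈ (Finset.univ : Finset V), f j ∈ Finset.range M :=
    ⟨Finset.univ.sup f + 1, fun j hj =>
      Finset.mem_range.2 (Nat.lt_succ_of_le (Finset.le_sup (f := f) hj))⟩
  calc ∑ j, Real.exp (-(p * D j)) ≤ ∑ j, Real.exp (-(f j : ℝ)) := by
        refine Finset.sum_le_sum fun j _ => Real.exp_le_exp.2 (neg_le_neg ?_)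
        exact Nat.floor_le (by positivity)
    _ = ∑ k ∈ Finset.range M, ∑ j with f j = k, Real.exp (-(f j : ℝ)) :=
        (Finset.sum_fiberwise_of_maps_to hM _).symm
    _ ≤ ∑ k ∈ Finset.range M, K * p ^ (-κ) * (((k : ℝ) + 1) ^ κ * Real.exp (-(k : ℝ))) := by
        refine Finset.sum_le_sum fun k _ => ?_
        have hk1 : (1 : ℝ) ≤ (k + 1) / p := by
          rw [le_div_iff₀ hp]; linarith [k.cast_nonneg (α := ℝ)]
        have hcard : ((Finset.univ.filter fun j => f j = k).card : ℝ) ≤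
            K * p ^ (-κ) * ((k : ℝ) + 1) ^ κ := by
          calc ((Finset.univ.filter fun j => f j = k).card : ℝ)
              ≤ ({j : V | (D j : ℝ) ≤ (k + 1) / p}.ncard : ℝ) := by
                rw [← Set.ncard_coe_finset]
                refine Nat.cast_le.2 (Set.ncard_le_ncard (fun j hj => ?_) (Set.toFinite _))
                simp only [Finset.coe_filter, Finset.mem_univ, true_and,
                  Set.mem_ofPred_eq] at hj ⊢
                rw [le_div_iff₀ hp, mul_comm, ← hj]
                exact (Nat.lt_floor_add_one _).le
            _ ≤ K * ((k + 1) / p) ^ κ := h _ hk1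
            _ = _ := by
                rw [Real.div_rpow (by positivity) hp.le, Real.rpow_neg hp.le]; ring
        calc ∑ j with f j = k, Real.exp (-(f j : ℝ))
            = (Finset.univ.filter fun j => f j = k).card * Real.exp (-(k : ℝ)) := by
              rw [← nsmul_eq_mul, ← Finset.sum_const]
              refine Finset.sum_congr rfl fun j hj => ?_
              rw [(Finset.mem_filter.1 hj).2]
          _ ≤ K * p ^ (-κ) * ((k : ℝ) + 1) ^ κ * Real.exp (-(k : ℝ)) := by gcongr
          _ = _ := by ring
    _ = K * p ^ (-κ) * ∑ k ∈ Finset.range M, (((k : ℝ) + 1) ^ κ * Real.exp (-(k : ℝ))) := by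
        rw [Finset.mul_sum]
    _ ≤ K * p ^ (-κ) * growthConst κ := by
        refine mul_le_mul_of_nonneg_left ?_ (by positivity)
        exact (summable_succ_rpow_mul_exp_neg κ).sum_le_tsum _ fun k _ => by positivity

variable {V : Type*} [Fintype V] [DecidableEq V] {G : SimpleGraph V} {B : Finset V}
  {α β γ δ : ℝ}

theorem one_sub_pow_le_exp {p : ℝ} (hp1 : p < 1) (n : ℕ) :
    (1 - p) ^ n ≤ Real.exp (-(p * n)) := by
  calc (1 - p) ^ n ≤ Real.exp (-p) ^ n :=
        pow_le_pow_left₀ (by linarith) (by linarith [Real.add_one_le_exp (-p)]) n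
    _ = Real.exp (-(p * n)) := by rw [← Real.exp_nat_mul]; ring_nf

theorem sum_pow_dist_le (hgrow : GrowthBounds G B α β γ δ) (hα : 0 < α) {i : V} (hi : i ∉ B)
    {p : ℝ} (hp : 0 < p) (hp1 : p < 1) :
    ∑ j ∈ Bᶜ, (1 - p) ^ G.dist i j ≤ α * p ^ (-β) * growthConst β := by
  calc ∑ j ∈ Bᶜ, (1 - p) ^ G.dist i j ≤ ∑ j, Real.exp (-(p * G.dist i j)) :=
        (Finset.sum_le_sum fun j _ => one_sub_pow_le_exp hp1 _).trans
          (Finset.sum_le_univ_sum_of_nonneg fun j => (Real.exp_pos _).le)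
    _ ≤ _ := sum_exp_neg_le (fun j => G.dist i j) hα.le (hgrow.1 i hi) hp hp1.le

theorem sum_boundaryDecay_le (hgrow : GrowthBounds G B α β γ δ) (hγ : 0 < γ)
    {p : ℝ} (hp : 0 < p) (hp1 : p < 1) :
    ∑ j ∈ Bᶜ, boundaryDecay G B (1 - p) j ≤
      γ * B.card * (p / 2) ^ (-δ) * growthConst δ := by
  by_cases hB : B.Nonempty
  swap
  · rw [Finset.not_nonempty_iff_eq_empty] at hB
    subst hB
    simp [boundaryDecay]
  calc ∑ j ∈ Bᶜ, boundaryDecay G B (1 - p) j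
      ≤ ∑ j, Real.exp (-(p / 2 * (B.inf' hB fun k => G.dist j k : ℕ))) := by
        refine (Finset.sum_le_sum fun j _ => ?_).trans
          (Finset.sum_le_univ_sum_of_nonneg fun j => (Real.exp_pos _).le)
        rw [boundaryDecay, dif_pos hB]
        refine le_trans (pow_le_pow_left₀ (Real.sqrt_nonneg _) ?_ _)
          (one_sub_pow_le_exp (p := p / 2) (by linarith) _)
        -- Here `√(1 - p) ≤ 1 - p / 2`, which is why the rate is `p / 2`.
        exact Real.sqrt_le_iff.2 ⟨by linarith, by nlinarith [sq_nonneg p]⟩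
    _ ≤ _ := by
        refine sum_exp_neg_le (fun j => B.inf' hB fun k => G.dist j k) (by positivity)
          (fun r hr => ?_) (by positivity) (by linarith)
        refine le_trans (le_of_eq ?_) (hgrow.2 r hr)
        congr 2
        ext j
        simp only [Set.mem_ofPred_eq]
        constructor
        · intro h
          obtain ⟨k, hk, hkeq⟩ := Finset.exists_mem_eq_inf' hB fun k => G.dist j k
          exact ⟨k, hk, by rwa [hkeq] at h⟩
        · rintro ⟨k, hk, hle⟩
          exact le_trans (by exact_mod_cast Finset.inf'_le _ hk) hle

end LayerCake

/-! ### Second moment of the overlap and the probability bound -/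

section Main

variable {V : Type*} [Fintype V] [DecidableEq V] {G : SimpleGraph V} [DecidableRel G.Adj]
  {B : Finset V} {τ : B → ℤˣ}

/-- For independent standard Gaussian vectors `X` and `Z`, the vector `ρ X + √(1 - ρ²) Z` is again
standard Gaussian; only null sets are needed here. -/
theorem quasiMeasurePreserving_noise {ι : Type*} [Fintype ι] {ρ : ℝ} (h0 : 0 < ρ) (h1 : ρ < 1) :
    Measure.QuasiMeasurePreserving
      (fun q : (ι → ℝ) × (ι → ℝ) => ρ • q.1 + √(1 - ρ ^ 2) • q.2)
      ((stdGaussianPi ι).prod (stdGaussianPi ι)) (stdGaussianPi ι) :=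
  (measurePreserving_fst.comp (measurePreserving_rotation (a := ρ) (b := √(1 - ρ ^ 2))
    (Real.sqrt_nonneg _)
    (by rw [Real.sq_sqrt (by nlinarith)]; ring))).quasiMeasurePreserving

theorem integrable_groundCorr_mul (i j : V) (ρ : ℝ) :
    Integrable (fun q : (G.edgeSet → ℝ) × (G.edgeSet → ℝ) =>
        groundCorr G B τ i j q.1 * groundCorr G B τ i j (ρ • q.1 + √(1 - ρ ^ 2) • q.2))
      ((stdGaussianPi G.edgeSet).prod (stdGaussianPi G.edgeSet)) := by
  have hm := measurable_groundCorr G B τ i j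
  refine integrable_of_abs_le_one ((hm.comp measurable_fst).mul (hm.comp (by fun_prop)))
    fun q => ?_
  rw [abs_mul]
  exact mul_le_one₀ (abs_groundCorr_le _ _ _ _ _ _) (abs_nonneg _) (abs_groundCorr_le _ _ _ _ _ _)

theorem integral_overlapSq (ρ : ℝ) :
    ∫ q, overlapSq G B τ q.1 (ρ • q.1 + √(1 - ρ ^ 2) • q.2)
        ∂((stdGaussianPi G.edgeSet).prod (stdGaussianPi G.edgeSet)) =
      ∑ i ∈ Bᶜ, ∑ j ∈ Bᶜ, gaussianCorr ρ (groundCorr G B τ i j) := by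
  unfold overlapSq
  rw [integral_finsetSum _ fun i _ => integrable_finsetSum _ fun j _ =>
    integrable_groundCorr_mul i j ρ]
  refine Finset.sum_congr rfl fun i _ => ?_
  rw [integral_finsetSum _ fun j _ => integrable_groundCorr_mul i j ρ]
  refine Finset.sum_congr rfl fun j _ => ?_
  rw [integral_prod _ (integrable_groundCorr_mul i j ρ)]
  simp only [integral_const_mul]
  rfl

theorem sum_gaussianCorr_le (hG : G.Connected) {α β γ δ : ℝ} (hα : 0 < α) (hγ : 0 < γ)
    (hgrow : GrowthBounds G B α β γ δ) {p : ℝ} (hp : 0 < p) (hp1 : p < 1) :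
    ∑ i ∈ Bᶜ, ∑ j ∈ Bᶜ, gaussianCorr (1 - p) (groundCorr G B τ i j) ≤
      (Bᶜ).card * (α * p ^ (-β) * growthConst β) +
        (γ * B.card * (p / 2) ^ (-δ) * growthConst δ) ^ 2 := by
  calc ∑ i ∈ Bᶜ, ∑ j ∈ Bᶜ, gaussianCorr (1 - p) (groundCorr G B τ i j)
      ≤ ∑ i ∈ Bᶜ, ∑ j ∈ Bᶜ, ((1 - p) ^ G.dist i j +
          boundaryDecay G B (1 - p) i * boundaryDecay G B (1 - p) j) :=
        Finset.sum_le_sum fun i _ => Finset.sum_le_sum fun j _ =>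
          gaussianCorr_groundCorr_le_add hG i j (by linarith) (by linarith)
    _ = ∑ i ∈ Bᶜ, ∑ j ∈ Bᶜ, (1 - p) ^ G.dist i j +
          (∑ i ∈ Bᶜ, boundaryDecay G B (1 - p) i) ^ 2 := by
        simp only [Finset.sum_add_distrib]
        rw [sq, Finset.sum_mul_sum]
    _ ≤ _ := by
        refine add_le_add ?_ (pow_le_pow_left₀
          (Finset.sum_nonneg fun i _ => boundaryDecay_nonneg _ _)
          (sum_boundaryDecay_le hgrow hγ hp hp1) 2)
        rw [← nsmul_eq_mul]
        exact Finset.sum_le_card_nsmul _ _ _ fun i hi =>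
          sum_pow_dist_le hgrow hα (Finset.mem_compl.1 hi) hp hp1

/-- Markov's inequality. Nonnegativity is obtained almost everywhere, from the representation as a
square, which relies on uniqueness for both environments. -/
theorem measureReal_overlapSq_ge_le (hG : G.Connected) {ρ : ℝ} (h0 : 0 < ρ) (h1 : ρ < 1)
    (hn : 0 < (Bᶜ).card) :
    ((stdGaussianPi G.edgeSet).prod (stdGaussianPi G.edgeSet)).real
        {q | ((Bᶜ).card : ℝ) ^ 2 / 4 ≤ overlapSq G B τ q.1 (ρ • q.1 + √(1 - ρ ^ 2) • q.2)} ≤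
      4 / ((Bᶜ).card : ℝ) ^ 2 * ∑ i ∈ Bᶜ, ∑ j ∈ Bᶜ, gaussianCorr ρ (groundCorr G B τ i j) := by
  set Γ := (stdGaussianPi G.edgeSet).prod (stdGaussianPi G.edgeSet)
  have hn' : (0 : ℝ) < (Bᶜ).card := by exact_mod_cast hn
  have hx : ∀ᵐ q ∂Γ, _ := measurePreserving_fst.quasiMeasurePreserving.ae
    (ae_groundState_unique (B := B) (τ := τ) hG)
  have hy : ∀ᵐ q ∂Γ, _ := (quasiMeasurePreserving_noise h0 h1).ae
    (ae_groundState_unique (B := B) (τ := τ) hG)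
  have hnn : 0 ≤ᵐ[Γ] fun q => overlapSq G B τ q.1 (ρ • q.1 + √(1 - ρ ^ 2) • q.2) := by
    filter_upwards [hx, hy] with q hq1 hq2
    obtain ⟨σ, hσ⟩ := exists_isGroundState (G := G) (B := B) (τ := τ) q.1
    obtain ⟨σ', hσ'⟩ := exists_isGroundState (G := G) (B := B) (τ := τ)
      (ρ • q.1 + √(1 - ρ ^ 2) • q.2)
    simp only [Pi.zero_apply]
    rw [overlapSq_eq hq1 hq2 hσ hσ']
    positivity
  have hint : Integrable (fun q => overlapSq G B τ q.1 (ρ • q.1 + √(1 - ρ ^ 2) • q.2)) Γ :=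
    integrable_finsetSum _ fun i _ => integrable_finsetSum _ fun j _ =>
      integrable_groundCorr_mul i j ρ
  have h := mul_meas_ge_le_integral_of_nonneg hnn hint (((Bᶜ).card : ℝ) ^ 2 / 4)
  rw [integral_overlapSq] at h
  rw [div_mul_eq_mul_div, le_div_iff₀ (by positivity)]
  linarith

theorem abs_sub_noise_le {p : ℝ} (hp : 0 < p) (hp1 : p < 1 / 2) {x z l : ℝ}
    (hx : |x| ≤ 3 * √l) (hz : |z| ≤ 3 * √l) :
    |x - ((1 - p) * x + √(1 - (1 - p) ^ 2) * z)| ≤ 7 * √(p * l) := by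
  have hs0 := Real.sqrt_nonneg p
  have hl0 := Real.sqrt_nonneg l
  have hps : √p * √p = p := Real.mul_self_sqrt hp.le
  -- The decimals 0.72 and 1.42 round up `√(1/2)` and `√2`; the final constant works because `3
  -- (0.72 + 1.42) < 7`.
  have hp7 : √p ≤ 0.72 := Real.sqrt_le_iff.2 ⟨by norm_num, by norm_num; linarith⟩
  have hnoise : √(1 - (1 - p) ^ 2) ≤ 1.42 * √p := by
    refine Real.sqrt_le_iff.2 ⟨by positivity, ?_⟩
    rw [mul_pow, Real.sq_sqrt hp.le]
    nlinarith
  rw [Real.sqrt_mul hp.le]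
  calc |x - ((1 - p) * x + √(1 - (1 - p) ^ 2) * z)|
      = |p * x - √(1 - (1 - p) ^ 2) * z| := by ring_nf
    _ ≤ |p * x| + |√(1 - (1 - p) ^ 2) * z| := abs_sub _ _
    _ = p * |x| + √(1 - (1 - p) ^ 2) * |z| := by
        rw [abs_mul, abs_mul, abs_of_pos hp, abs_of_nonneg (Real.sqrt_nonneg _)]
    _ ≤ p * (3 * √l) + (1.42 * √p) * (3 * √l) := by gcongr
    _ = (√p + 1.42) * 3 * (√p * √l) := by linear_combination (-3 * √l) * hps
    _ ≤ 7 * (√p * √l) := by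
        refine mul_le_mul_of_nonneg_right ?_ (by positivity)
        linarith

/-- The cutoff `3 √(log N)` gives a tail `N ^ (-9/2) ≤ N ^ (-4)`. This beats the union bound over
the `N` coordinates of both vectors, since `4 ≤ N ^ 2`. -/
theorem four_mul_exp_le {N : ℕ} (hN : 2 ≤ N) :
    (N : ℝ) * (2 * Real.exp (-(3 * √(Real.log N)) ^ 2 / 2)) +
      N * (2 * Real.exp (-(3 * √(Real.log N)) ^ 2 / 2)) ≤ 1 / N := by
  have hN2 : (2 : ℝ) ≤ N := by exact_mod_cast hN
  have hlog : 0 ≤ Real.log N := Real.log_nonneg (by linarith)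
  have hexp : Real.exp (-(3 * √(Real.log N)) ^ 2 / 2) ≤ ((N : ℝ) ^ 4)⁻¹ := by
    have : ((N : ℝ) ^ 4)⁻¹ = Real.exp (-(4 * Real.log N)) := by
      rw [Real.exp_neg, ← Real.exp_log (show (0 : ℝ) < N by linarith), ← Real.exp_nat_mul,
        Real.log_exp]
      norm_num
    rw [this, mul_pow, Real.sq_sqrt hlog]
    exact Real.exp_le_exp.2 (by linarith)
  calc _ = 4 * N * Real.exp (-(3 * √(Real.log N)) ^ 2 / 2) := by ring
    _ ≤ 4 * N * ((N : ℝ) ^ 4)⁻¹ := by gcongr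
    _ = 4 / (N : ℝ) ^ 2 * (1 / N) := by field_simp
    _ ≤ 1 * (1 / N) := by
        gcongr
        rw [div_le_one (by positivity)]
        nlinarith
    _ = _ := one_mul _

theorem stdGaussianPi_largeRatioSet_le (hG : G.Connected) (hE : 2 ≤ G.edgeFinset.card)
    (hn : 0 < (Bᶜ).card) {α β γ δ : ℝ} (hα : 0 < α) (hγ : 0 < γ)
    (hgrow : GrowthBounds G B α β γ δ) {p : ℝ} (hp : 0 < p) (hp1 : p < 1 / 2) :
    (stdGaussianPi G.edgeSet).real
        (largeRatioSet G B τ (15 * √(p * Real.log G.edgeFinset.card))) ≤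
      1 / (G.edgeFinset.card : ℝ) + 4 / ((Bᶜ).card : ℝ) ^ 2 *
        ((Bᶜ).card * (α * p ^ (-β) * growthConst β) +
          (γ * B.card * (p / 2) ^ (-δ) * growthConst δ) ^ 2) := by
  set μ := stdGaussianPi G.edgeSet with hμ
  set N := G.edgeFinset.card with hN
  have hcard : Fintype.card G.edgeSet = N := by rw [hN, SimpleGraph.edgeFinset_card]
  have hN2 : (2 : ℝ) ≤ N := by exact_mod_cast hE
  have hlog : 0 < Real.log N := Real.log_pos (by linarith)
  set L := 3 * √(Real.log N) with hL
  -- The factor 15 exceeds `2 * 7`: the couplings differ by at most `7 √(p log N)`, and each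
  -- boundary edge costs at most twice that.
  set t := 15 * √(p * Real.log N) with ht
  have hsq : 0 < √(p * Real.log N) := Real.sqrt_pos.2 (by positivity)
  set ρ := 1 - p with hρ
  have h0 : 0 < ρ := by linarith
  have h1 : ρ < 1 := by linarith
  have hx : ∀ᵐ q ∂(μ.prod μ), _ := measurePreserving_fst.quasiMeasurePreserving.ae
    (ae_groundState_unique (B := B) (τ := τ) hG)
  have hy : ∀ᵐ q ∂(μ.prod μ), _ := (quasiMeasurePreserving_noise h0 h1).ae
    (ae_groundState_unique (B := B) (τ := τ) hG)
  have hbigm : MeasurableSet {x : G.edgeSet → ℝ | ∃ e, L < |x e|} := by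
    have h : {x : G.edgeSet → ℝ | ∃ e, L < |x e|} = ⋃ e, {x | L < |x e|} := by ext; simp
    rw [h]
    exact MeasurableSet.iUnion fun e => measurableSet_lt measurable_const (by fun_prop)
  -- Up to null sets, a large ratio requires a large coordinate in `J` or in the noise, or a large
  -- overlap.
  have hsub : Prod.fst ⁻¹' largeRatioSet G B τ t ≤ᵐ[μ.prod μ]
      ((Prod.fst ⁻¹' {x | ∃ e, L < |x e|} ∪ Prod.snd ⁻¹' {x | ∃ e, L < |x e|}) ∪
        {q | ((Bᶜ).card : ℝ) ^ 2 / 4 ≤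
          overlapSq G B τ q.1 (ρ • q.1 + √(1 - ρ ^ 2) • q.2)} :
        Set ((G.edgeSet → ℝ) × (G.edgeSet → ℝ))) := by
    filter_upwards [hx, hy] with q hq1 hq2 hq
    obtain ⟨σ, hσ, hle⟩ := hq
    by_contra hnot
    have hnot' : ¬ (((∃ e, L < |q.1 e|) ∨ ∃ e, L < |q.2 e|) ∨ ((Bᶜ).card : ℝ) ^ 2 / 4 ≤
      overlapSq G B τ q.1 (ρ • q.1 + √(1 - ρ ^ 2) • q.2)) := hnot
    push Not at hnot'
    refine absurd hle (not_le.2 (minInterfaceRatio_lt hq1 hq2 hσ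
      (D := 7 * √(p * Real.log N)) (fun e => ?_) (by positivity) (by linarith) hnot'.2))
    exact abs_sub_noise_le hp hp1 (hnot'.1.1 e) (hnot'.1.2 e)
  have hfst := (measurePreserving_fst (μ := μ) (ν := μ)).measureReal_preimage
    (measurableSet_largeRatioSet (G := G) (B := B) (τ := τ) t).nullMeasurableSet
  have hbig1 := (measurePreserving_fst (μ := μ) (ν := μ)).measureReal_preimage
    hbigm.nullMeasurableSet
  have hbig2 := (measurePreserving_snd (μ := μ) (ν := μ)).measureReal_preimage
    hbigm.nullMeasurableSet
  have htail := stdGaussianPi_exists_abs_gt_le (ι := G.edgeSet) (L := L) (by positivity)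
  rw [hcard] at htail
  rw [← hfst]
  have hmono : (μ.prod μ).real (Prod.fst ⁻¹' largeRatioSet G B τ t) ≤ _ :=
    ENNReal.toReal_mono (measure_ne_top _ _) (measure_mono_ae hsub)
  refine hmono.trans ((measureReal_union_le _ _).trans (add_le_add ?_ ?_))
  · refine (measureReal_union_le _ _).trans ?_
    rw [hbig1, hbig2]
    exact (add_le_add htail htail).trans (four_mul_exp_le hE)
  · refine (measureReal_overlapSq_ge_le hG h0 h1 hn).trans ?_
    exact mul_le_mul_of_nonneg_left (sum_gaussianCorr_le hG hα hγ hgrow hp (by linarith))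
      (by positivity)

end Main

end EdwardsAnderson

theorem mainTheorem3 :
    ∃ C₁ : ℝ, 0 < C₁ ∧
      ∀ α β γ δ : ℝ, 0 < α → 0 < β → 0 < γ → 0 < δ →
        ∃ C₂ : ℝ, 0 < C₂ ∧
          ∀ (V : Type*) [Fintype V] [DecidableEq V] (G : SimpleGraph V) [DecidableRel G.Adj]
            (B : Finset V) (τ : B → ℤˣ),
            G.Connected →
            (G.induce {i : V | i ∉ B}).Connected →
            2 ≤ G.edgeFinset.card →
            EdwardsAnderson.GrowthBounds G B α β γ δ →
            ∀ (Ω : Type*) [MeasurableSpace Ω] (P : Measure Ω) [IsProbabilityMeasure P]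
              (J : G.edgeSet → Ω → ℝ),
              iIndepFun J P →
              (∀ e, HasLaw (J e) (gaussianReal 0 1) P) →
              ∀ σ : Ω → V → ℤˣ,
                (∀ᵐ ω ∂P, EdwardsAnderson.IsGroundState G B τ (fun e => J e ω) (σ ω)) →
                ∀ p : ℝ, 0 < p → p < 1 / 2 →
                  P.real {ω | ((C₁ * √(p * Real.log G.edgeFinset.card) : ℝ) : WithTop ℝ) ≤
                      EdwardsAnderson.minInterfaceRatio G B (fun e => J e ω) (σ ω)} ≤
                    1 / (G.edgeFinset.card : ℝ) + 4 / ((Bᶜ).card : ℝ) +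
                      C₂ * (((Bᶜ).card : ℝ) * p ^ (-β) + (B.card : ℝ) ^ 2 * p ^ (-2 * δ)) /
                        ((Bᶜ).card : ℝ) ^ 2 := by
  refine ⟨15, by norm_num, fun α β γ δ hα hβ hγ hδ => ?_⟩
  set c₁ := 4 * (α * EdwardsAnderson.growthConst β) with hc₁
  -- The 4 is the Markov factor, and `2 ^ δ` comes from `(p / 2) ^ (-δ)`.
  set c₂ := 4 * (γ * 2 ^ δ * EdwardsAnderson.growthConst δ) ^ 2 with hc₂
  have hc₁0 : 0 ≤ c₁ := by have := EdwardsAnderson.growthConst_nonneg β; positivity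
  have hc₂0 : 0 ≤ c₂ := by positivity
  refine ⟨c₁ + c₂ + 1, by positivity, ?_⟩
  intro V _ _ G _ B τ hG hind hE hgrow Ω _ P _ J hindep hlaw σ hσ p hp hp1
  have hn : 0 < (Bᶜ).card := by
    obtain ⟨v⟩ := hind.nonempty
    exact Finset.card_pos.2 ⟨v, Finset.mem_compl.2 v.2⟩
  have hn' : (0 : ℝ) < (Bᶜ).card := by exact_mod_cast hn
  have hJ := hindep.hasLaw_pi hlaw
  set t := 15 * √(p * Real.log G.edgeFinset.card)
  -- The selection `σ` need not be measurable; its event is contained, up to a null set, in the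
  -- measurable event that some ground state has a large ratio.
  have hle : P.real {ω | (t : WithTop ℝ) ≤
        EdwardsAnderson.minInterfaceRatio G B (fun e => J e ω) (σ ω)} ≤
      P.real {ω | (fun e => J e ω) ∈ EdwardsAnderson.largeRatioSet G B τ t} := by
    refine ENNReal.toReal_mono (measure_ne_top _ _) (measure_mono_ae ?_)
    filter_upwards [hσ] with ω hω h
    exact ⟨σ ω, hω, h⟩
  rw [hJ.measureReal_eq (p := fun x => x ∈ EdwardsAnderson.largeRatioSet G B τ t)
    (EdwardsAnderson.measurableSet_largeRatioSet t)] at hle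
  refine hle.trans ((EdwardsAnderson.stdGaussianPi_largeRatioSet_le hG hE hn hα hγ hgrow
    hp hp1).trans ?_)
  have hpβ : 0 < p ^ (-β) := Real.rpow_pos_of_pos hp _
  have hpδ : (p / 2) ^ (-δ) = 2 ^ δ * p ^ (-δ) := by
    rw [Real.div_rpow hp.le two_pos.le, Real.rpow_neg two_pos.le, div_inv_eq_mul, mul_comm]
  have hp2δ : p ^ (-2 * δ) = (p ^ (-δ)) ^ 2 := by
    rw [← Real.rpow_natCast, ← Real.rpow_mul hp.le]
    congr 1
    push_cast; ring
  rw [hpδ, hp2δ]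
  set n : ℝ := ((Bᶜ).card : ℝ)
  set b : ℝ := (B.card : ℝ)
  have hmain : 4 / n ^ 2 * (n * (α * p ^ (-β) * EdwardsAnderson.growthConst β) +
      (γ * b * (2 ^ δ * p ^ (-δ)) * EdwardsAnderson.growthConst δ) ^ 2) =
      (c₁ * (n * p ^ (-β)) + c₂ * (b ^ 2 * (p ^ (-δ)) ^ 2)) / n ^ 2 := by
    rw [hc₁, hc₂]; ring
  rw [hmain]
  -- The bound already obtained does not involve `4 / n`; this term is pure slack.
  have h4 : 0 ≤ 4 / n := by positivity
  have hnum : c₁ * (n * p ^ (-β)) + c₂ * (b ^ 2 * (p ^ (-δ)) ^ 2) ≤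
      (c₁ + c₂ + 1) * (n * p ^ (-β) + b ^ 2 * (p ^ (-δ)) ^ 2) := by
    have hX : 0 ≤ n * p ^ (-β) := by positivity
    have hY : 0 ≤ b ^ 2 * (p ^ (-δ)) ^ 2 := by positivity
    nlinarith [mul_nonneg hc₁0 hY, mul_nonneg hc₂0 hX]
  have hdiv := div_le_div_of_nonneg_right hnum (sq_nonneg n)
  linarith
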